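/- Let $\mathbb{T}=\mathbb{R}/\mathbb{Z}$ and let $M(\mathbb{T})$ be the Banach algebra of complex Borel measures on $\mathbb{T}$ with convolution and the total variation norm. Regard $L^1(\mathbb{T})$ (with respect to normalized Haar measure, with convolution and the $L^1$ norm) as a subset of $M(\mathbb{T})$ via $f\mapsto f\,dx$. Put $$r(L^1(\mathbb{T}))=\{\mu\in M(\mathbb{T}):\ \mu^{*n}\in L^1(\mathbb{T})\text{ for some } n\ge 1\},$$ let $A$ be the norm closure of $r(L^1(\mathbb{T}))$ in $M(\mathbb{T})$, and let $B=L^1(\mathbb{T})$. For a commutative complex Banach algebra $R$ let $\triangle(R)$ be its Gelfand space, i.e. the set of nonzero multiplicative linear functionals with the weak$^*$ topology; $R$ is semisimple if for each $0\ne x\in R$ some $\varphi\in\triangle(R)$ has $\varphi(x)\neq0$, and radical if $\triangle(R)=\emptyset$. For distinct $\varphi_1,\dots,\varphi_n\in\triangle(R)$ the Nevanlinna–Pick norm on $\mathbb{C}^n$ is $$\|(a_1,\dots,a_n)\|_{NP(R;\varphi_1,\dots,\varphi_n)}=\inf\{\|x\|_R:\ x\in R,\ \varphi_i(x)=a_i\text{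 for } i=1,\dots,n\}.$$ Then $A$ (a closed subalgebra of $M(\mathbb{T})$) and $B$ are commutative semisimple Banach algebras, and the following hold. 1. $\triangle(A)=\triangle(B)=\mathbb{Z}$: the map sending $k\in\mathbb{Z}$ to the functional $\mu\mapsto\widehat{\mu}(k)=\int e^{-2\pi i kx}\,d\mu(x)$ is a homeomorphism from $\mathbb{Z}$ (discrete) onto $\triangle(A)$, and likewise $k\mapsto(f\mapsto\widehat f(k))$ is a homeomorphism from $\mathbb{Z}$ onto $\triangle(B)$. 2. With this identification all Nevanlinna–Pick norms of $A$ and $B$ coincide: for all distinct integers $k_1,\dots,k_n$ and all $(a_1,\dots,a_n)\in\mathbb{C}^n$, $$\|(a_1,\dots,a_n)\|_{NP(A;k_1,\dots,k_n)}=\|(a_1,\dots,a_n)\|_{NP(B;k_1,\dots,k_n)}.$$ 3. $A$ and $B$ are not isomorphic, not even as complex algebras without regard to topology. 4. $L^1(\mathbb{T})$ is a proper closed ideal of $A$ and the quotient $A/L^1(\mathbb{T})$ is radical, whereas for no proper closed ideal $I$ of $L^1(\mathbb{T})$ is $L^1(\mathbb{T})/I$ radical. -/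

import Mathlib

noncomputable section

open MeasureTheory Set
open scoped ENNReal

namespace CircleAlg

/-- Every complex measure has finite total variation. -/
instance finite_variation {X : Type*} [MeasurableSpace X] (μ : ComplexMeasure X) :
    IsFiniteMeasure μ.variation := by
  have hle : μ.variation ≤ (ComplexMeasure.re μ).variation + (ComplexMeasure.im μ).variation := by
    refine VectorMeasure.variation_le_of_forall_enorm_le fun E _ => ?_
    have h1 : ‖μ E‖ₑ ≤ ‖(μ E).re‖ₑ + ‖(μ E).im‖ₑ := by
      rw [← ofReal_norm, ← ofReal_norm, ← ofReal_norm,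
        ← ENNReal.ofReal_add (norm_nonneg _) (norm_nonneg _)]
      exact ENNReal.ofReal_le_ofReal (Complex.norm_le_abs_re_add_abs_im _)
    refine h1.trans (add_le_add ?_ ?_)
    · exact VectorMeasure.enorm_measure_le_variation (ComplexMeasure.re μ) E
    · exact VectorMeasure.enorm_measure_le_variation (ComplexMeasure.im μ) E
  rw [← SignedMeasure.totalVariation_eq_variation, ← SignedMeasure.totalVariation_eq_variation]
    at hle
  exact isFiniteMeasure_of_le _ hle

section Prod

variable {X Y Z : Type*} [MeasurableSpace X] [MeasurableSpace Y] [MeasurableSpace Z]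

/-- The product measure `μ × ν` of two complex measures. -/
def cprod (μ : ComplexMeasure X) (ν : ComplexMeasure Y) : ComplexMeasure (X × Y) :=
  μ.prod ν (ContinuousLinearMap.mul ℝ ℂ)

theorem cprod_apply (μ : ComplexMeasure X) (ν : ComplexMeasure Y) (s : Set X) (t : Set Y) :
    cprod μ ν (s ×ˢ t) = μ s * ν t := by
  simp [cprod]

theorem cprod_eq {μ : ComplexMeasure X} {ν : ComplexMeasure Y} {ρ : ComplexMeasure (X × Y)}
    (h : ∀ s t, MeasurableSet s → MeasurableSet t → ρ (s ×ˢ t) = μ s * ν t) :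
    cprod μ ν = ρ :=
  VectorMeasure.prod_eq_of_forall_apply_prod (by simpa using h)

theorem cprod_add (μ : ComplexMeasure X) (ν ν' : ComplexMeasure Y) :
    cprod μ (ν + ν') = cprod μ ν + cprod μ ν' :=
  cprod_eq fun s t _ _ => by simp [cprod_apply, mul_add]

theorem cprod_smul (c : ℂ) (μ : ComplexMeasure X) (ν : ComplexMeasure Y) :
    cprod (c • μ) ν = c • cprod μ ν :=
  cprod_eq fun s t _ _ => by simp [cprod_apply, mul_assoc]

theorem cprod_swap (μ : ComplexMeasure X) (ν : ComplexMeasure Y) :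
    (cprod μ ν).map Prod.swap = cprod ν μ := by
  refine (cprod_eq fun s t hs ht => ?_).symm
  rw [VectorMeasure.map_apply _ measurable_swap (hs.prod ht), preimage_swap_prod, cprod_apply,
    mul_comm]

theorem cprod_map_left {W : Type*} [MeasurableSpace W] (μ : ComplexMeasure X)
    (ν : ComplexMeasure Y) {f : X → W} (hf : Measurable f) :
    (cprod μ ν).map (Prod.map f id) = cprod (μ.map f) ν := by
  refine (cprod_eq fun s t hs ht => ?_).symm
  rw [VectorMeasure.map_apply _ (hf.prodMap measurable_id) (hs.prod ht),
    show Prod.map f id ⁻¹' s ×ˢ t = (f ⁻¹' s) ×ˢ t from rfl, cprod_apply, VectorMeasure.map_apply _ hf hs]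

theorem cprod_map_right {W : Type*} [MeasurableSpace W] (μ : ComplexMeasure X)
    (ν : ComplexMeasure Y) {f : Y → W} (hf : Measurable f) :
    (cprod μ ν).map (Prod.map id f) = cprod μ (ν.map f) := by
  refine (cprod_eq fun s t hs ht => ?_).symm
  rw [VectorMeasure.map_apply _ (measurable_id.prodMap hf) (hs.prod ht),
    show Prod.map id f ⁻¹' s ×ˢ t = s ×ˢ (f ⁻¹' t) from rfl, cprod_apply, VectorMeasure.map_apply _ hf ht]

theorem cprod_assoc (μ : ComplexMeasure X) (ν : ComplexMeasure Y) (ρ : ComplexMeasure Z) :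
    (cprod (cprod μ ν) ρ).map MeasurableEquiv.prodAssoc = cprod μ (cprod ν ρ) := by
  refine (cprod_eq fun s u hs hu => ?_).symm
  have hm : Measurable fun p : (X × Y) × Z => (p.1.2, p.2) := by fun_prop
  have hS : MeasurableSet {p : (X × Y) × Z | p.1.1 ∈ s} := by
    have : Measurable fun p : (X × Y) × Z => p.1.1 := by fun_prop
    exact this hs
  have key : cprod (μ s • ν) ρ =
      ((cprod (cprod μ ν) ρ).restrict {p | p.1.1 ∈ s}).map fun p => (p.1.2, p.2) := by
    refine cprod_eq fun t v ht hv => ?_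
    rw [VectorMeasure.map_apply _ hm (ht.prod hv),
      VectorMeasure.restrict_apply _ hS (hm (ht.prod hv))]
    have : ((fun p : (X × Y) × Z => (p.1.2, p.2)) ⁻¹' (t ×ˢ v)) ∩ {p | p.1.1 ∈ s} =
        (s ×ˢ t) ×ˢ v := by ext ⟨⟨x, y⟩, z⟩; simp; tauto
    rw [this, cprod_apply, cprod_apply]
    simp
  have h2 := congrArg (fun σ => σ u) key
  simp only [cprod_smul] at h2
  rw [VectorMeasure.map_apply _ hm hu, VectorMeasure.restrict_apply _ hS (hm hu)] at h2
  rw [VectorMeasure.map_apply _ MeasurableEquiv.prodAssoc.measurable (hs.prod hu)]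
  have h3 : (MeasurableEquiv.prodAssoc : (X × Y) × Z ≃ᵐ X × Y × Z) ⁻¹' (s ×ˢ u) =
      ((fun p : (X × Y) × Z => (p.1.2, p.2)) ⁻¹' u) ∩ {p | p.1.1 ∈ s} := by
    ext ⟨⟨x, y⟩, z⟩; simp [MeasurableEquiv.prodAssoc]; tauto
  rw [h3, ← h2]
  simp

end Prod

/-- `M(𝕋)`: the complex Borel measures on the circle `𝕋 = ℝ / ℤ`. -/
def MT : Type := ComplexMeasure UnitAddCircle

namespace MT

instance : AddCommGroup MT := inferInstanceAs (AddCommGroup (ComplexMeasure UnitAddCircle))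
instance : Module ℂ MT := inferInstanceAs (Module ℂ (ComplexMeasure UnitAddCircle))

/-- The underlying complex measure. -/
def val (μ : MT) : ComplexMeasure UnitAddCircle := μ

/-- Convolution: the image of the product measure under addition. -/
def conv (μ ν : MT) : MT := (cprod μ.val ν.val).map fun p => p.1 + p.2

theorem add_measurable : Measurable fun p : UnitAddCircle × UnitAddCircle => p.1 + p.2 := by
  fun_prop

theorem map_map {X Y Z : Type*} [MeasurableSpace X] [MeasurableSpace Y] [MeasurableSpace Z]
    (μ : ComplexMeasure X) {f : X → Y} {g : Y → Z} (hf : Measurable f) (hg : Measurable g) :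
    (μ.map f).map g = μ.map (g ∘ f) := by
  ext s hs
  rw [VectorMeasure.map_apply _ hg hs, VectorMeasure.map_apply _ hf (hg hs),
    VectorMeasure.map_apply _ (hg.comp hf) hs, preimage_comp]

theorem conv_comm (μ ν : MT) : conv μ ν = conv ν μ := by
  unfold conv
  rw [← cprod_swap, map_map _ measurable_swap add_measurable]
  congr 1
  ext p
  simp [add_comm]

theorem conv_add (μ ν ρ : MT) : conv μ (ν + ρ) = conv μ ν + conv μ ρ := by
  unfold conv
  exact (congrArg (fun σ => VectorMeasure.map σ fun p => p.1 + p.2)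
    (cprod_add μ.val ν.val ρ.val)).trans (VectorMeasure.map_add _ _ _)

theorem smul_conv (c : ℂ) (μ ν : MT) : conv (c • μ) ν = c • conv μ ν := by
  unfold conv
  exact (congrArg (fun σ => VectorMeasure.map σ fun p => p.1 + p.2)
    (cprod_smul c μ.val ν.val)).trans (VectorMeasure.map_smul _)

theorem conv_assoc (μ ν ρ : MT) : conv (conv μ ν) ρ = conv μ (conv ν ρ) := by
  change (cprod ((cprod μ.val ν.val).map _) ρ.val).map _ =
    (cprod μ.val ((cprod ν.val ρ.val).map _)).map _
  rw [← cprod_map_left _ _ add_measurable, ← cprod_map_right _ _ add_measurable, ← cprod_assoc,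
    map_map _ (add_measurable.prodMap measurable_id) add_measurable,
    map_map _ (measurable_id.prodMap add_measurable) add_measurable,
    map_map _ (MeasurableEquiv.measurable _)
      (add_measurable.comp (measurable_id.prodMap add_measurable))]
  congr 1
  ext p
  simp [MeasurableEquiv.prodAssoc, add_assoc]

/-- The unit mass at `0`. -/
def delta : MT := VectorMeasure.dirac (0 : UnitAddCircle) (1 : ℂ)

theorem delta_conv (μ : MT) : conv delta μ = μ := by
  have h : cprod delta.val μ.val = μ.val.map (Prod.mk (0 : UnitAddCircle)) := by
    refine cprod_eq fun s t hs ht => ?_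
    rw [VectorMeasure.map_apply _ measurable_prodMk_left (hs.prod ht)]
    by_cases h0 : (0 : UnitAddCircle) ∈ s
    · simp [delta, val, hs, h0]
    · simpa [delta, val, hs, h0] using μ.val.empty
  unfold conv
  rw [h, map_map _ measurable_prodMk_left add_measurable]
  have : ((fun p : UnitAddCircle × UnitAddCircle => p.1 + p.2) ∘ Prod.mk 0) = id := by
    ext x; simp
  rw [this]
  exact VectorMeasure.map_id _

/-- `M(𝕋)` as a commutative ring under convolution. -/
instance : CommRing MT :=
  { (inferInstance : AddCommGroup MT) with
    mul := conv
    one := delta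
    mul_comm := conv_comm
    mul_assoc := conv_assoc
    left_distrib := conv_add
    right_distrib := fun a b c => by
      change conv (a + b) c = conv a c + conv b c
      rw [conv_comm, conv_add, conv_comm c, conv_comm c]
    zero_mul := fun a => by
      change conv 0 a = 0
      simpa using smul_conv 0 0 a
    mul_zero := fun a => by
      change conv a 0 = 0
      rw [conv_comm]
      simpa using smul_conv 0 0 a
    one_mul := delta_conv
    mul_one := fun a => (conv_comm a delta).trans (delta_conv a) }

theorem mul_def (μ ν : MT) : μ * ν = conv μ ν := rfl

instance : Algebra ℂ MT :=
  Algebra.ofModule (fun c μ ν => smul_conv c μ ν) fun c μ ν => by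
    rw [mul_comm, mul_comm μ ν]; exact smul_conv c ν μ

/-- The total variation norm. -/
instance : Norm MT := ⟨fun μ => (μ.val.variation univ).toReal⟩

theorem norm_def (μ : MT) : ‖μ‖ = (μ.val.variation univ).toReal := rfl

theorem norm_add_le' (μ ν : MT) : ‖μ + ν‖ ≤ ‖μ‖ + ‖ν‖ := by
  have h : (μ + ν).val.variation univ ≤ μ.val.variation univ + ν.val.variation univ :=
    VectorMeasure.variation_add_le (μ := μ.val) (ν := ν.val) univ
  rw [norm_def, norm_def, norm_def, ← ENNReal.toReal_add (measure_ne_top _ _) (measure_ne_top _ _)]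
  exact ENNReal.toReal_mono (by finiteness) h

theorem norm_smul' (c : ℂ) (μ : MT) : ‖c • μ‖ = ‖c‖ * ‖μ‖ := by
  have h : (c • μ).val.variation = ‖c‖₊ • μ.val.variation := VectorMeasure.variation_smul
  rw [norm_def, norm_def, h]
  simp

theorem norm_conv_le (μ ν : MT) : ‖μ * ν‖ ≤ ‖μ‖ * ‖ν‖ := by
  have h1 : (μ * ν).val.variation univ ≤ (cprod μ.val ν.val).variation univ := by
    have := VectorMeasure.variation_map_le (μ := cprod μ.val ν.val)
      (φ := fun p : UnitAddCircle × UnitAddCircle => p.1 + p.2) univ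
    rwa [Measure.map_apply add_measurable MeasurableSet.univ, preimage_univ] at this
  have h2 : (cprod μ.val ν.val).variation univ ≤ μ.val.variation univ * ν.val.variation univ := by
    have := VectorMeasure.variation_prod_le (μ := μ.val) (ν := ν.val)
      (B := ContinuousLinearMap.mul ℝ ℂ) univ
    refine this.trans ?_
    rw [Measure.smul_apply, ← univ_prod_univ, Measure.prod_prod, smul_eq_mul]
    refine mul_le_of_le_one_left' ?_
    rw [← ofReal_norm, ContinuousLinearMap.opNorm_mul, ENNReal.ofReal_one]
  rw [norm_def, norm_def, norm_def, ← ENNReal.toReal_mul]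
  exact ENNReal.toReal_mono (by finiteness) (h1.trans h2)

instance : NormedAddCommGroup MT :=
  AddGroupNorm.toNormedAddCommGroup
    { toFun := fun μ => ‖μ‖
      map_zero' := by simpa using norm_smul' 0 0
      add_le' := norm_add_le'
      neg' := fun μ => by simpa using norm_smul' (-1) μ
      eq_zero_of_map_eq_zero' := fun μ h => by
        have h0 : μ.val.variation univ = 0 := by
          rcases (ENNReal.toReal_eq_zero_iff _).1 h with h | h
          · exact h
          · exact absurd h (measure_ne_top _ _)
        exact VectorMeasure.variation_eq_zero.1 (Measure.measure_univ_eq_zero.1 h0) }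

/-- `M(𝕋)` with convolution and the total variation norm. -/
instance : NormedCommRing MT :=
  { (inferInstance : NormedAddCommGroup MT), (inferInstance : CommRing MT) with
    norm_mul_le := norm_conv_le }

instance : NormedAlgebra ℂ MT :=
  { (inferInstance : Algebra ℂ MT) with norm_smul_le := fun c μ => (norm_smul' c μ).le }


/-- The Fourier–Stieltjes coefficient `∫ e^{-2πikx} dμ(x)`. -/
def coeff (μ : MT) (k : ℤ) : ℂ :=
  μ.val.integral (fun x => fourier (-k) x) (ContinuousLinearMap.mul ℝ ℂ)

end MT

open AddCircle (haarAddCircle)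

/-- `L¹(𝕋)` with respect to the normalized Haar measure. -/
def L1T : Type := Lp ℂ 1 (haarAddCircle (T := 1))

namespace L1T

instance : NormedAddCommGroup L1T :=
  inferInstanceAs (NormedAddCommGroup (Lp ℂ 1 (haarAddCircle (T := 1))))
instance : NormedSpace ℂ L1T :=
  inferInstanceAs (NormedSpace ℂ (Lp ℂ 1 (haarAddCircle (T := 1))))
instance : CompleteSpace L1T :=
  inferInstanceAs (CompleteSpace (Lp ℂ 1 (haarAddCircle (T := 1))))

/-- The underlying element of Mathlib's `L¹` space. -/
def val (f : L1T) : Lp ℂ 1 (haarAddCircle (T := 1)) := f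

/-- A function on the circle representing the class `f`. -/
def fn (f : L1T) : UnitAddCircle → ℂ := f.val

theorem integrable_fn (f : L1T) : Integrable f.fn (haarAddCircle (T := 1)) :=
  L1.integrable_coeFn f.val

/-- The class of an integrable function. -/
def mk (g : UnitAddCircle → ℂ) (hg : Integrable g (haarAddCircle (T := 1))) : L1T := hg.toL1 g

theorem fn_mk (g : UnitAddCircle → ℂ) (hg : Integrable g (haarAddCircle (T := 1))) :
    (mk g hg).fn =ᵐ[haarAddCircle] g :=
  hg.coeFn_toL1

theorem convolution_integrable (f g : L1T) :
    Integrable (convolution f.fn g.fn (ContinuousLinearMap.mul ℂ ℂ) (haarAddCircle (T := 1)))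
      (haarAddCircle (T := 1)) :=
  f.integrable_fn.integrable_convolution _ g.integrable_fn

/-- The product of `L¹(𝕋)` is convolution, `(f * g)(x) = ∫ f(t) g(x - t) dt`. -/
instance : Mul L1T := ⟨fun f g => mk _ (convolution_integrable f g)⟩

theorem fn_mul (f g : L1T) : (f * g).fn =ᵐ[haarAddCircle]
    convolution f.fn g.fn (ContinuousLinearMap.mul ℂ ℂ) (haarAddCircle (T := 1)) :=
  fn_mk _ (convolution_integrable f g)

/-- The measure `f dx`: the inclusion of `L¹(𝕋)` into `M(𝕋)`. -/
def toMT (f : L1T) : MT := (haarAddCircle (T := 1)).withDensityᵥ f.fn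

theorem toMT_apply (f : L1T) {s : Set UnitAddCircle} (hs : MeasurableSet s) :
    f.toMT.val s = ∫ x in s, f.fn x ∂(haarAddCircle (T := 1)) :=
  withDensityᵥ_apply f.integrable_fn hs

theorem toMT_mk (g : UnitAddCircle → ℂ) (hg : Integrable g (haarAddCircle (T := 1))) :
    (mk g hg).toMT = (haarAddCircle (T := 1)).withDensityᵥ g :=
  (Integrable.withDensityᵥ_eq_iff (mk g hg).integrable_fn hg).2 (fn_mk g hg)

theorem toMT_injective : Function.Injective toMT := fun f g h =>
  Lp.ext ((Integrable.withDensityᵥ_eq_iff f.integrable_fn g.integrable_fn).1 h)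

theorem toMT_add (f g : L1T) : (f + g).toMT = f.toMT + g.toMT := by
  have h : (haarAddCircle (T := 1)).withDensityᵥ (f + g).fn =
      (haarAddCircle (T := 1)).withDensityᵥ (f.fn + g.fn) :=
    (Integrable.withDensityᵥ_eq_iff (f + g).integrable_fn
      (f.integrable_fn.add g.integrable_fn)).2 (Lp.coeFn_add f.val g.val)
  exact h.trans (withDensityᵥ_add f.integrable_fn g.integrable_fn)

theorem toMT_smul (c : ℂ) (f : L1T) : (c • f).toMT = c • f.toMT := by
  have h : (haarAddCircle (T := 1)).withDensityᵥ (c • f).fn =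
      (haarAddCircle (T := 1)).withDensityᵥ (c • f.fn) :=
    (Integrable.withDensityᵥ_eq_iff (c • f).integrable_fn
      (f.integrable_fn.smul c)).2 (Lp.coeFn_smul c f.val)
  exact h.trans (withDensityᵥ_smul _ _)

theorem norm_toMT (f : L1T) : ‖f.toMT‖ = ‖f‖ := by
  have h1 : f.toMT.val.variation =
      (haarAddCircle (T := 1)).withDensity (fun x => ‖f.fn x‖ₑ) :=
    Measure.variation_withDensityᵥ f.integrable_fn
  rw [MT.norm_def, h1, withDensity_apply _ MeasurableSet.univ, Measure.restrict_univ]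
  have h2 : ‖f‖ = (eLpNorm f.fn 1 (haarAddCircle (T := 1))).toReal := rfl
  rw [h2, eLpNorm_one_eq_lintegral_enorm]

theorem toMT_mul (f g : L1T) : (f * g).toMT = f.toMT * g.toMT := by
  have hint : Integrable (fun p : UnitAddCircle × UnitAddCircle => f.fn p.1 * g.fn p.2)
      ((haarAddCircle (T := 1)).prod (haarAddCircle (T := 1))) :=
    f.integrable_fn.mul_prod g.integrable_fn
  have hprod : cprod f.toMT.val g.toMT.val =
      ((haarAddCircle (T := 1)).prod (haarAddCircle (T := 1))).withDensityᵥ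
        (fun p => f.fn p.1 * g.fn p.2) := by
    refine cprod_eq fun s t hs ht => ?_
    rw [withDensityᵥ_apply hint (hs.prod ht), setIntegral_prod_mul, toMT_apply _ hs,
      toMT_apply _ ht]
  refine (toMT_mk _ (convolution_integrable f g)).trans ?_
  change _ = (cprod f.toMT.val g.toMT.val).map _
  rw [hprod]
  ext s hs
  rw [withDensityᵥ_apply (convolution_integrable f g) hs,
    VectorMeasure.map_apply _ MT.add_measurable hs,
    withDensityᵥ_apply hint (MT.add_measurable hs),
    ← integral_indicator hs, ← integral_indicator (MT.add_measurable hs)]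
  have hc := f.integrable_fn.convolution_integrand (ContinuousLinearMap.mul ℂ ℂ) g.integrable_fn
  have hc' : Integrable (fun p : UnitAddCircle × UnitAddCircle =>
      s.indicator (fun _ => (1 : ℂ)) p.1 * (f.fn p.2 * g.fn (p.1 - p.2)))
      ((haarAddCircle (T := 1)).prod (haarAddCircle (T := 1))) := by
    refine (hc.indicator (measurable_fst hs)).congr (Filter.Eventually.of_forall fun p => ?_)
    by_cases hp : p.1 ∈ s <;> simp [indicator, hp]
  have hshear := measurePreserving_add_prod (haarAddCircle (T := 1)) (haarAddCircle (T := 1))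
  have e1 : ∀ x, s.indicator (convolution f.fn g.fn (ContinuousLinearMap.mul ℂ ℂ)
      (haarAddCircle (T := 1))) x = ∫ t, s.indicator (fun _ => (1 : ℂ)) x *
        (f.fn t * g.fn (x - t)) ∂(haarAddCircle (T := 1)) := fun x => by
    by_cases hx : x ∈ s <;> simp [indicator, hx, convolution]
  simp_rw [e1]
  rw [← integral_prod (f := fun p : UnitAddCircle × UnitAddCircle =>
      s.indicator (fun _ => (1 : ℂ)) p.1 * (f.fn p.2 * g.fn (p.1 - p.2))) hc']
  have hmap := integral_map (μ := (haarAddCircle (T := 1)).prod (haarAddCircle (T := 1)))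
    (φ := fun z : UnitAddCircle × UnitAddCircle => (z.1 + z.2, z.2))
    hshear.measurable.aemeasurable (f := fun p : UnitAddCircle × UnitAddCircle =>
      s.indicator (fun _ => (1 : ℂ)) p.1 * (f.fn p.2 * g.fn (p.1 - p.2)))
    (by rw [hshear.map_eq]; exact hc'.aestronglyMeasurable)
  rw [hshear.map_eq] at hmap
  rw [hmap, ← integral_prod_swap]
  refine integral_congr_ae (Filter.Eventually.of_forall fun p => ?_)
  by_cases hp : p.1 + p.2 ∈ s
  · simp [indicator, hp, add_comm p.2]
  · simp [indicator, hp, add_comm p.2]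

/-- `L¹(𝕋)` as a commutative ring under convolution. -/
instance : NonUnitalCommRing L1T :=
  { (inferInstance : AddCommGroup L1T), (inferInstance : Mul L1T) with
    mul_comm := fun f g => toMT_injective (by rw [toMT_mul, toMT_mul, mul_comm])
    mul_assoc := fun f g h => toMT_injective (by simp only [toMT_mul, mul_assoc])
    left_distrib := fun f g h => toMT_injective (by simp only [toMT_mul, toMT_add, mul_add])
    right_distrib := fun f g h => toMT_injective (by simp only [toMT_mul, toMT_add, add_mul])
    zero_mul := fun f => toMT_injective (by
      have h0 : (0 : L1T).toMT = 0 := by simpa using toMT_smul 0 0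
      rw [toMT_mul, h0, zero_mul])
    mul_zero := fun f => toMT_injective (by
      have h0 : (0 : L1T).toMT = 0 := by simpa using toMT_smul 0 0
      rw [toMT_mul, h0, mul_zero]) }

/-- `L¹(𝕋)` with convolution and the `L¹` norm. -/
instance : NonUnitalNormedCommRing L1T :=
  { (inferInstance : NormedAddCommGroup L1T), (inferInstance : NonUnitalCommRing L1T) with
    norm_mul_le := fun f g => by
      rw [← norm_toMT, ← norm_toMT f, ← norm_toMT g, toMT_mul]
      exact norm_mul_le _ _ }

instance : IsScalarTower ℂ L1T L1T :=
  ⟨fun c f g => toMT_injective (by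
    simp only [smul_eq_mul, toMT_mul, toMT_smul, smul_mul_assoc])⟩

instance : SMulCommClass ℂ L1T L1T :=
  ⟨fun c f g => toMT_injective (by
    simp only [smul_eq_mul, toMT_mul, toMT_smul, mul_smul_comm])⟩

theorem exists_toMT_eq_iff (μ : MT) : (∃ f : L1T, f.toMT = μ) ↔
    ∀ s, MeasurableSet s → haarAddCircle (T := 1) s = 0 → μ.val s = 0 := by
  constructor
  · rintro ⟨f, rfl⟩ s hs h0
    rw [toMT_apply f hs, Measure.restrict_eq_zero.2 h0, integral_zero_measure]
  · intro h
    have hac : μ.val ≪ᵥ (haarAddCircle (T := 1)).toENNRealVectorMeasure := by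
      refine VectorMeasure.AbsolutelyContinuous.mk fun s hs h0 => ?_
      rw [Measure.toENNRealVectorMeasure_apply_measurable hs] at h0
      exact h s hs h0
    obtain ⟨h1, h2⟩ := (ComplexMeasure.absolutelyContinuous_ennreal_iff _ _).1 hac
    have r1 := SignedMeasure.withDensityᵥ_rnDeriv_eq _ _ h1
    have r2 := SignedMeasure.withDensityᵥ_rnDeriv_eq _ _ h2
    have i1 := SignedMeasure.integrable_rnDeriv (ComplexMeasure.re μ.val) (haarAddCircle (T := 1))
    have i2 := SignedMeasure.integrable_rnDeriv (ComplexMeasure.im μ.val) (haarAddCircle (T := 1))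
    have i3 := i1.ofReal (𝕜 := ℂ) |>.add ((i2.ofReal (𝕜 := ℂ)).mul_const Complex.I)
    refine ⟨mk _ i3, ?_⟩
    rw [toMT_mk]
    refine VectorMeasure.ext fun s hs => ?_
    rw [withDensityᵥ_apply i3 hs]
    have j1 := congrArg (fun σ => σ s) r1
    have j2 := congrArg (fun σ => σ s) r2
    simp only [withDensityᵥ_apply i1 hs, withDensityᵥ_apply i2 hs] at j1 j2
    simp only [Pi.add_apply]
    rw [integral_add (i1.ofReal (𝕜 := ℂ)).restrict ((i2.ofReal (𝕜 := ℂ)).mul_const _).restrict,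
      integral_mul_const, integral_ofReal, integral_ofReal, j1, j2]
    exact Complex.re_add_im (μ.val s)

/-- `L¹(𝕋)` is an ideal of `M(𝕋)`. -/
def idealMT : Ideal MT where
  carrier := {μ | ∃ f : L1T, f.toMT = μ}
  zero_mem' := ⟨0, by simpa using toMT_smul 0 0⟩
  add_mem' := by
    rintro _ _ ⟨f, rfl⟩ ⟨g, rfl⟩
    exact ⟨f + g, toMT_add f g⟩
  smul_mem' := by
    rintro ν _ ⟨f, rfl⟩
    refine (exists_toMT_eq_iff _).2 fun s hs h0 => ?_
    rw [smul_eq_mul]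
    change (cprod ν.val f.toMT.val).map _ s = 0
    rw [VectorMeasure.map_apply _ MT.add_measurable hs, cprod,
      VectorMeasure.prod_apply_eq_integral (MT.add_measurable hs)]
    have hz : ∀ x : UnitAddCircle, f.toMT.val
        (Prod.mk x ⁻¹' ((fun p : UnitAddCircle × UnitAddCircle => p.1 + p.2) ⁻¹' s)) = 0 := by
      intro x
      refine (exists_toMT_eq_iff _).1 ⟨f, rfl⟩ _
        (measurable_prodMk_left (MT.add_measurable hs)) ?_
      exact (measure_preimage_add (haarAddCircle (T := 1)) x s).trans h0
    simp [hz]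

end L1T

/-- `r(L¹(𝕋))`: the measures some convolution power (with exponent `≥ 1`) of which lies in
`L¹(𝕋)`. -/
def rootsL1 : Set MT := {μ | ∃ n : ℕ, 1 ≤ n ∧ ∃ f : L1T, f.toMT = μ ^ n}

theorem rootsL1_eq : rootsL1 = (L1T.idealMT.radical : Set MT) := by
  ext μ
  constructor
  · rintro ⟨n, -, h⟩
    exact ⟨n, h⟩
  · rintro ⟨n, h⟩
    exact ⟨n + 1, by omega, by rw [pow_succ]; exact L1T.idealMT.mul_mem_right _ h⟩

/-- The closure of `r(L¹(𝕋))` in `M(𝕋)`, as a closed subalgebra. -/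
def algA : NonUnitalSubalgebra ℂ MT where
  carrier := closure rootsL1
  zero_mem' := by
    rw [rootsL1_eq]
    exact L1T.idealMT.radical.closure.zero_mem
  add_mem' := by
    rw [rootsL1_eq]
    exact L1T.idealMT.radical.closure.add_mem
  mul_mem' := fun {a b} _ hb => by
    rw [rootsL1_eq] at *
    exact L1T.idealMT.radical.closure.mul_mem_left a hb
  smul_mem' := fun c x hx => by
    rw [rootsL1_eq] at *
    rw [Algebra.smul_def]
    exact L1T.idealMT.radical.closure.mul_mem_left _ hx

instance : NormedSpace ℂ algA :=
  { (inferInstance : Module ℂ algA) with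
    norm_smul_le := fun c x => norm_smul_le c (x : MT) }

section General

variable (R : Type*) [NonUnitalNormedCommRing R] [NormedSpace ℂ R]

/-- Semisimplicity: the characters separate the points from zero. -/
def IsGelfandSemisimple : Prop :=
  ∀ x : R, x ≠ 0 → ∃ φ : WeakDual.characterSpace ℂ R, φ x ≠ 0

variable {R}

/-- The Nevanlinna–Pick norm of `a` for the characters `φ 1, …, φ n`. -/
def npNorm {n : ℕ} (φ : Fin n → WeakDual.characterSpace ℂ R) (a : Fin n → ℂ) : ℝ :=
  sInf {r : ℝ | ∃ x : R, (∀ i, φ i x = a i) ∧ r = ‖x‖}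

end General

section Ideals

variable (R : Type*) [NonUnitalCommRing R] [Module ℂ R]

/-- An ideal of a commutative complex algebra that need not have a unit: a linear subspace stable
under multiplication by all elements. -/
structure AlgIdeal extends Submodule ℂ R where
  mul_mem' : ∀ (a : R) {x : R}, x ∈ carrier → a * x ∈ carrier

/-- A commutative complex algebra is radical if it has no nonzero multiplicative linear
functional. -/
def IsRadicalAlgebra : Prop := ∀ φ : R →ₙₐ[ℂ] ℂ, φ = 0

variable {R}

namespace AlgIdeal

/-- The quotient algebra. -/
def Quotient (I : AlgIdeal R) : Type _ := R ⧸ I.toSubmodule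

variable (I : AlgIdeal R)

instance : AddCommGroup I.Quotient := inferInstanceAs (AddCommGroup (R ⧸ I.toSubmodule))
instance : Module ℂ I.Quotient := inferInstanceAs (Module ℂ (R ⧸ I.toSubmodule))

/-- The coset of an element. -/
def coset (x : R) : I.Quotient := Submodule.Quotient.mk (p := I.toSubmodule) x

theorem coset_surjective : Function.Surjective I.coset := Submodule.Quotient.mk_surjective _

/-- Multiplication of cosets, `(x + I) (y + I) = x y + I`. -/
instance : Mul I.Quotient :=
  ⟨_root_.Quotient.map₂ (· * ·) fun x x' hx y y' hy => by
    have hx : x - x' ∈ I.toSubmodule := (Submodule.quotientRel_def _).1 hx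
    have hy : y - y' ∈ I.toSubmodule := (Submodule.quotientRel_def _).1 hy
    refine (Submodule.quotientRel_def I.toSubmodule).2 ?_
    have h : x * y - x' * y' = y * (x - x') + x' * (y - y') := by
      rw [mul_sub, mul_sub, mul_comm y x, mul_comm y x']; abel
    rw [h]
    exact I.add_mem (I.mul_mem' y hx) (I.mul_mem' x' hy)⟩

theorem coset_mul (x y : R) : I.coset (x * y) = I.coset x * I.coset y := rfl

theorem coset_add (x y : R) : I.coset (x + y) = I.coset x + I.coset y := rfl

instance : NonUnitalCommRing I.Quotient :=
  { (inferInstance : AddCommGroup I.Quotient), (inferInstance : Mul I.Quotient) with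
    mul_comm := fun a b => by
      obtain ⟨x, rfl⟩ := I.coset_surjective a
      obtain ⟨y, rfl⟩ := I.coset_surjective b
      rw [← coset_mul, mul_comm, coset_mul]
    mul_assoc := fun a b c => by
      obtain ⟨x, rfl⟩ := I.coset_surjective a
      obtain ⟨y, rfl⟩ := I.coset_surjective b
      obtain ⟨z, rfl⟩ := I.coset_surjective c
      simp only [← coset_mul, mul_assoc]
    left_distrib := fun a b c => by
      obtain ⟨x, rfl⟩ := I.coset_surjective a
      obtain ⟨y, rfl⟩ := I.coset_surjective b
      obtain ⟨z, rfl⟩ := I.coset_surjective c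
      simp only [← coset_mul, ← coset_add, mul_add]
    right_distrib := fun a b c => by
      obtain ⟨x, rfl⟩ := I.coset_surjective a
      obtain ⟨y, rfl⟩ := I.coset_surjective b
      obtain ⟨z, rfl⟩ := I.coset_surjective c
      simp only [← coset_mul, ← coset_add, add_mul]
    zero_mul := fun a => by
      obtain ⟨x, rfl⟩ := I.coset_surjective a
      change I.coset (0 * x) = I.coset 0
      rw [zero_mul]
    mul_zero := fun a => by
      obtain ⟨x, rfl⟩ := I.coset_surjective a
      change I.coset (x * 0) = I.coset 0
      rw [mul_zero] }

end AlgIdeal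

end Ideals

/-- `L¹(𝕋)` as an ideal of the closure of `r(L¹(𝕋))`. -/
def idealL1 : AlgIdeal algA where
  carrier := {μ | ∃ f : L1T, f.toMT = μ}
  zero_mem' := L1T.idealMT.zero_mem
  add_mem' := fun {a b} ha hb => L1T.idealMT.add_mem ha hb
  smul_mem' := by
    rintro c x ⟨f, hf⟩
    exact ⟨c • f, by rw [L1T.toMT_smul, hf]; rfl⟩
  mul_mem' := fun a x hx => L1T.idealMT.mul_mem_left (a : MT) hx

end CircleAlg

end

noncomputable section

open MeasureTheory Set
open scoped ENNReal
open AddCircle (haarAddCircle)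

namespace CircleAlg

/-! Write `e_k` for the exponential of frequency `k`. Everything about characters rests on the
eigenvector relation `μ * e_k = μ̂(k) e_k` (`mul_toMT_char`): it makes coefficients multiplicative
and shows that a multiplicative functional nonzero at `e_k` is the `k`-th coefficient. On an ideal
of `M(𝕋)` every multiplicative functional is automatically contractive, by a Neumann series
(`norm_apply_le_of_ideal`). A nonzero one on `L¹` is therefore nonzero at some `e_k`, since
trigonometric polynomials are dense. One on `A` that kills `L¹` kills all roots of `L¹` and, by
contractivity, their closure; so `A` has only the characters coming from `ℤ`, and `A / L¹` is
radical. A proper closed ideal of `L¹` misses some `e_k`, and the `k`-th coefficient then survives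
in the quotient.

The Nevanlinna–Pick norms agree because convolution with an approximate identity moves a measure
into `L¹` without raising the norm and almost without changing finitely many coefficients; a small
trigonometric polynomial repairs the rest (`exists_L1T_coeff_eq`).

An algebra isomorphism from `A` to `L¹` has a continuous inverse, which must send each exponential
to a multiple of an exponential, so its image lies in `L¹`. This contradicts `L¹ ≠ A`.

That `L¹ ≠ A` is the analytic core. The Riesz product with factors `1 + a_j cos(2π 3^j x)`, `a_j =
(j + 1)^(-1/2)`, has `∑ a_j ^ 4 < ∞`, so its convolution square has square-summable coefficients and
lies in `L¹`; but `∑ a_j ^ 2 = ∞`, and a weak law of large numbers shows that it is not absolutely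
continuous. -/

theorem integrable_of_continuous {E : Type*} [NormedAddCommGroup E]
    {P : Measure UnitAddCircle} [IsFiniteMeasure P] {g : UnitAddCircle → E} (hg : Continuous g) :
    Integrable g P := by
  have := hg.continuousOn.integrableOn_compact (μ := P) isCompact_univ
  rwa [MeasureTheory.integrableOn_univ] at this

/-! ### Uniqueness of Fourier–Stieltjes coefficients and completeness of `M(𝕋)`. -/

namespace MT

/-- The integral of a function against a complex measure. -/
def pairing (μ : MT) (g : UnitAddCircle → ℂ) : ℂ :=
  μ.val.integral g (ContinuousLinearMap.mul ℝ ℂ)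

theorem coeff_eq_pairing (μ : MT) (k : ℤ) : μ.coeff k = μ.pairing (fourier (-k)) := rfl

theorem pairing_smul (μ : MT) (c : ℂ) (g : UnitAddCircle → ℂ) :
    μ.pairing (c • g) = c • μ.pairing g := by
  refine setToFun_smul _ (fun c s x => ?_) c g
  change (c • x) * μ.val s = c • (x * μ.val s)
  simp [mul_assoc]

theorem pairing_add (μ : MT) {f g : UnitAddCircle → ℂ} (hf : Continuous f) (hg : Continuous g) :
    μ.pairing (f + g) = μ.pairing f + μ.pairing g :=
  VectorMeasure.integral_add (integrable_of_continuous hf) (integrable_of_continuous hg)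

theorem norm_pairing_le (μ : MT) {g : UnitAddCircle → ℂ} {C : ℝ} (hg : ∀ x, ‖g x‖ ≤ C) :
    ‖μ.pairing g‖ ≤ C * ‖μ‖ := by
  have := VectorMeasure.norm_integral_le_of_norm_le_const (μ := μ.val) (f := g)
    (B := ContinuousLinearMap.mul ℝ ℂ) (C := C) (Filter.Eventually.of_forall hg)
  rwa [ContinuousLinearMap.opNorm_mul, mul_one] at this

theorem pairing_indicator (μ : MT) {s : Set UnitAddCircle} (hs : MeasurableSet s) :
    μ.pairing (s.indicator fun _ => 1) = μ.val s := by
  unfold pairing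
  rw [VectorMeasure.integral_indicator_const _ hs]
  simp

/-- A complex measure with vanishing Fourier–Stieltjes coefficients is zero. -/
theorem eq_zero_of_coeff_eq_zero {μ : MT} (h : ∀ k, μ.coeff k = 0) : μ = 0 := by
  -- Vanishing spreads by density: from exponentials to continuous functions in the sup norm, then
  -- to `L¹(|μ|)`, which contains the indicators.
  have hC : ∀ g : C(UnitAddCircle, ℂ), μ.pairing g = 0 := by
    let Λ : C(UnitAddCircle, ℂ) →ₗ[ℂ] ℂ :=
      { toFun := fun g => μ.pairing g
        map_add' := fun f g => μ.pairing_add f.continuous g.continuous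
        map_smul' := fun c g => μ.pairing_smul c g }
    have hΛ : Continuous Λ := by
      refine AddMonoidHomClass.continuous_of_bound Λ ‖μ‖ fun g => ?_
      rw [mul_comm]
      exact μ.norm_pairing_le fun x => g.norm_coe_le_norm x
    have hker : (Submodule.span ℂ (range (fourier (T := 1)))).topologicalClosure ≤ Λ.ker := by
      refine Submodule.topologicalClosure_minimal _ (Submodule.span_le.2 ?_)
        (isClosed_singleton.preimage hΛ)
      rintro _ ⟨k, rfl⟩
      have := h (-k)
      rw [coeff_eq_pairing, neg_neg] at this
      exact this
    intro g
    rw [span_fourier_closure_eq_top] at hker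
    exact hker (Submodule.mem_top (x := g))
  have hL : ∀ g : Lp ℂ 1 μ.val.variation, μ.pairing g = 0 := by
    have hcont : Continuous fun g : Lp ℂ 1 μ.val.variation => μ.pairing g :=
      VectorMeasure.continuous_integral
    have hd := ContinuousMap.toLp_denseRange (p := 1) ℂ μ.val.variation ℂ (by simp)
    intro g
    refine hd.induction_on (p := fun g => μ.pairing g = 0) g (isClosed_singleton.preimage hcont) ?_
    intro g
    rw [← hC g]
    exact VectorMeasure.integral_congr_ae (ContinuousMap.coeFn_toLp _ g)
  refine VectorMeasure.ext fun s hs => ?_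
  change μ.val s = 0
  rw [← μ.pairing_indicator hs,
    ← hL (indicatorConstLp 1 hs (measure_ne_top μ.val.variation s) (1 : ℂ))]
  exact VectorMeasure.integral_congr_ae indicatorConstLp_coeFn.symm

/-- Needed for Neumann series in `M(𝕋)` and for the completeness of `A`. An absolutely convergent
series of measures is summed set by set; the variations bound the double series over terms and
disjoint pieces, so the sums may be exchanged and the result is countably additive. -/
instance : CompleteSpace MT := by
  refine NormedAddCommGroup.completeSpace_of_summable_imp_tendsto fun u hu => ?_
  have hle : ∀ n s, ‖(u n).val s‖ ≤ ‖u n‖ := fun n s => by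
    refine (VectorMeasure.norm_measure_le_variation (μ := (u n).val) (E := s)).trans ?_
    exact measureReal_mono (subset_univ s)
  have hs : ∀ s, Summable fun n => (u n).val s := fun s => .of_norm_bounded hu fun n => hle n s
  have hvs : ∀ {f : ℕ → Set UnitAddCircle}, (∀ i, MeasurableSet (f i)) →
      Pairwise (Function.onFun Disjoint f) → ∀ n,
      Summable (fun i => ‖(u n).val (f i)‖) ∧ ∑' i, ‖(u n).val (f i)‖ ≤ ‖u n‖ := by
    intro f hf hd n
    have h1 : ∑' i, (u n).val.variation (f i) ≤ (u n).val.variation univ := by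
      rw [← measure_iUnion hd hf]
      exact measure_mono (subset_univ _)
    have h2 : HasSum (fun i => ((u n).val.variation (f i)).toReal)
        (∑' i, (u n).val.variation (f i)).toReal := by
      have hne := ne_top_of_le_ne_top (measure_ne_top _ _) h1
      rw [ENNReal.tsum_toReal_eq fun i => measure_ne_top _ _]
      exact ENNReal.hasSum_toReal hne
    have h3 : ∀ i, ‖(u n).val (f i)‖ ≤ ((u n).val.variation (f i)).toReal := fun i =>
      VectorMeasure.norm_measure_le_variation
    have h4 := Summable.of_nonneg_of_le (fun i => norm_nonneg _) h3 h2.summable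
    refine ⟨h4, (h4.tsum_le_tsum h3 h2.summable).trans ?_⟩
    rw [h2.tsum_eq]
    exact ENNReal.toReal_mono (measure_ne_top _ _) h1
  let σ : ComplexMeasure UnitAddCircle :=
    { measureOf' := fun s => ∑' n, (u n).val s
      empty' := by simp
      not_measurable' := fun s h => by simp [VectorMeasure.not_measurable _ h]
      m_iUnion' := fun f hf hd => by
        have hsum : Summable fun p : ℕ × ℕ => (u p.1).val (f p.2) := by
          refine Summable.of_norm ?_
          refine (summable_prod_of_nonneg fun p => norm_nonneg _).2
            ⟨fun n => (hvs hf hd n).1, ?_⟩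
          exact .of_nonneg_of_le (fun n => tsum_nonneg fun i => norm_nonneg _)
            (fun n => (hvs hf hd n).2) hu
        have e : ∑' n, (u n).val (⋃ i, f i) = ∑' i, ∑' n, (u n).val (f i) := by
          rw [hsum.tsum_comm]
          exact tsum_congr fun n => (VectorMeasure.m_iUnion (u n).val hf hd).tsum_eq.symm
        rw [e]
        have hsum' : Summable fun p : ℕ × ℕ => (u p.2).val (f p.1) := hsum.prod_symm
        exact hsum'.prod.hasSum }
  let τ : MT := σ
  refine ⟨τ, ?_⟩
  rw [tendsto_iff_norm_sub_tendsto_zero]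
  have htail : Filter.Tendsto (fun n => ∑' i, ‖u (i + n)‖) Filter.atTop (nhds 0) :=
    tendsto_sum_nat_add fun i => ‖u i‖
  refine squeeze_zero (fun n => norm_nonneg _) (fun n => ?_) htail
  have hn : Summable fun i => ‖u (i + n)‖ := (summable_nat_add_iff n).2 hu
  rw [norm_sub_rev]
  have hsum : ∀ i, (u i).val.variation univ = ENNReal.ofReal ‖u i‖ := fun i =>
    (ENNReal.ofReal_toReal (measure_ne_top _ _)).symm
  have hval : ∀ s, (τ - ∑ i ∈ Finset.range n, u i).val s = ∑' i, (u (i + n)).val s := by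
    intro s
    have h1 : ∀ m, (∑ i ∈ Finset.range m, u i).val s = ∑ i ∈ Finset.range m, (u i).val s := by
      intro m
      induction m with
      | zero => rfl
      | succ m ih => rw [Finset.sum_range_succ, Finset.sum_range_succ, ← ih]; rfl
    have h2 := (hs s).sum_add_tsum_nat_add n
    calc (τ - ∑ i ∈ Finset.range n, u i).val s
        = ∑' i, (u i).val s - (∑ i ∈ Finset.range n, u i).val s := rfl
      _ = _ := by rw [h1, ← h2]; ring
  -- The variation is the least measure dominating the set function, so the tail of the series is
  -- controlled by the sum of the variations.
  have hvar : (τ - ∑ i ∈ Finset.range n, u i).val.variation ≤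
      Measure.sum fun i => (u (i + n)).val.variation := by
    refine VectorMeasure.variation_le_of_forall_enorm_le fun s hs => ?_
    rw [hval, Measure.sum_apply _ hs]
    exact enorm_tsum_le_tsum_enorm.trans
      (ENNReal.tsum_le_tsum fun i => VectorMeasure.enorm_measure_le_variation _ s)
  rw [norm_def]
  refine ENNReal.toReal_le_of_le_ofReal (tsum_nonneg fun i => norm_nonneg _) ?_
  refine (hvar univ).trans ?_
  rw [Measure.sum_apply _ MeasurableSet.univ,
    ENNReal.ofReal_tsum_of_nonneg (fun i => norm_nonneg _) hn]
  exact ENNReal.tsum_le_tsum fun i => (hsum _).le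

end MT

/-! ### Exponentials as eigenvectors of convolution. -/

theorem fourier_add_apply (k : ℤ) (x y : UnitAddCircle) :
    fourier k (x + y) = fourier k x * fourier k y := by
  simp only [fourier_apply, smul_add, AddCircle.toCircle_add, Circle.coe_mul]

theorem norm_fourier_apply (k : ℤ) (x : UnitAddCircle) : ‖fourier k x‖ = 1 :=
  Circle.norm_coe _

namespace L1T

/-- The exponential `x ↦ e^{2πikx}` as an element of `L¹(𝕋)`. -/
def char (k : ℤ) : L1T := mk (fourier k) (integrable_of_continuous (fourier k).continuous)

theorem fn_char (k : ℤ) : (char k).fn =ᵐ[haarAddCircle] fourier k := fn_mk _ _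

theorem toMT_char_apply (k : ℤ) {s : Set UnitAddCircle} (hs : MeasurableSet s) :
    (char k).toMT.val s = ∫ x in s, fourier k x ∂(haarAddCircle (T := 1)) := by
  rw [char, toMT_mk]
  exact withDensityᵥ_apply (integrable_of_continuous (fourier k).continuous) hs

/-- Translating an exponential multiplies it by a scalar. The algebraic properties of coefficients
are read off from this relation, without further integration. -/
theorem mul_toMT_char (μ : MT) (k : ℤ) : μ * (char k).toMT = μ.coeff k • (char k).toMT := by
  refine VectorMeasure.ext fun s hs => ?_
  change (cprod μ.val (char k).toMT.val).map _ s = μ.coeff k * (char k).toMT.val s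
  rw [VectorMeasure.map_apply _ MT.add_measurable hs, cprod,
    VectorMeasure.prod_apply_eq_integral (MT.add_measurable hs)]
  -- By invariance of Haar measure, translating `s` by `-x` multiplies its `e_k`-mass by
  -- `e_{-k}(x)`.
  have hz : ∀ x : UnitAddCircle, (char k).toMT.val
      (Prod.mk x ⁻¹' ((fun p : UnitAddCircle × UnitAddCircle => p.1 + p.2) ⁻¹' s)) =
      ((char k).toMT.val s • fun x => fourier (-k) x) x := by
    intro x
    rw [toMT_char_apply _ (measurable_prodMk_left (MT.add_measurable hs)), toMT_char_apply _ hs,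
      ← integral_indicator hs, ← integral_indicator
        (measurable_prodMk_left (MT.add_measurable hs)),
      ← integral_add_left_eq_self (s.indicator _) x, Pi.smul_apply, smul_eq_mul,
      ← integral_mul_const]
    refine integral_congr_ae (Filter.Eventually.of_forall fun y => ?_)
    by_cases hy : x + y ∈ s
    · simp only [indicator, mem_preimage, hy, if_true]
      rw [fourier_add_apply, mul_right_comm, ← fourier_add]
      simp
    · simp [indicator, hy]
  simp_rw [hz]
  have hflip : (ContinuousLinearMap.mul ℝ ℂ).flip = ContinuousLinearMap.mul ℝ ℂ := by
    ext; simp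
  rw [hflip]
  exact (μ.pairing_smul _ _).trans (mul_comm _ _)

theorem norm_char (k : ℤ) : ‖char k‖ = 1 := by
  have h2 : ‖char k‖ = (eLpNorm (char k).fn 1 (haarAddCircle (T := 1))).toReal := rfl
  rw [h2, eLpNorm_congr_ae (fn_char k), eLpNorm_one_eq_lintegral_enorm]
  have h1 : ∀ x : UnitAddCircle, ‖fourier k x‖ₑ = 1 := fun x => by
    rw [← ofReal_norm, norm_fourier_apply, ENNReal.ofReal_one]
  simp_rw [h1]
  simp

theorem char_ne_zero (k : ℤ) : char k ≠ 0 := by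
  intro h
  have := norm_char k
  simp [h] at this

theorem toMT_zero : (0 : L1T).toMT = 0 := by simpa using toMT_smul 0 0

theorem toMT_char_ne_zero (k : ℤ) : (char k).toMT ≠ 0 := by
  rw [← toMT_zero]
  exact fun h => char_ne_zero k (toMT_injective h)

theorem mul_char (f : L1T) (k : ℤ) : f * char k = fourierCoeff f.fn k • char k := by
  refine Lp.ext ((fn_mul f (char k)).trans ?_)
  refine Filter.EventuallyEq.trans ?_ (Lp.coeFn_smul (fourierCoeff f.fn k) (char k).val).symm
  filter_upwards [fn_char k] with x hx
  have hx' : (char k).val x = fourier k x := hx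
  rw [Pi.smul_apply, hx']
  -- The representative of `char k` is an exponential only almost everywhere; `t ↦ x - t` pulls null
  -- sets back to null sets.
  have hae : ∀ᵐ t ∂(haarAddCircle (T := 1)), (char k).fn (x - t) = fourier k (x - t) :=
    (quasiMeasurePreserving_sub_left_of_right_invariant _ x).ae (fn_char k)
  rw [convolution, fourierCoeff, smul_eq_mul, ← integral_mul_const]
  refine integral_congr_ae (hae.mono fun t ht => ?_)
  have : fourier k (x - t) = fourier k x * fourier (-k) t := by
    rw [sub_eq_add_neg, fourier_add_apply]
    simp [fourier_apply]
  simp only [ht, this, ContinuousLinearMap.mul_apply', smul_eq_mul]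
  ring

/-- Both numbers are the eigenvalue of convolution by `f` on the nonzero vector `char k`. -/
theorem coeff_toMT (f : L1T) (k : ℤ) : f.toMT.coeff k = fourierCoeff f.fn k := by
  have h := mul_toMT_char f.toMT k
  rw [← toMT_mul, mul_char, toMT_smul] at h
  exact (smul_left_injective ℂ (toMT_char_ne_zero k) h).symm

theorem coeff_char (k j : ℤ) : (char k).toMT.coeff j = if j = k then 1 else 0 := by
  rw [coeff_toMT, fourierCoeff_congr_ae (fn_char k), fourierCoeff]
  simp only [smul_eq_mul, ← fourier_add]
  have h := orthonormal_iff_ite.1 (orthonormal_fourier (T := 1)) j k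
  rw [ContinuousMap.inner_toLp] at h
  rw [← h]
  refine integral_congr_ae (Filter.Eventually.of_forall fun t => ?_)
  simp only [← fourier_neg]
  rw [fourier_add, mul_comm]

end L1T

namespace MT

open L1T

theorem coeff_unique {μ : MT} {k : ℤ} {c : ℂ} (h : μ * (char k).toMT = c • (char k).toMT) :
    μ.coeff k = c :=
  smul_left_injective ℂ (toMT_char_ne_zero k) ((mul_toMT_char μ k).symm.trans h)

theorem coeff_add (μ ν : MT) (k : ℤ) : (μ + ν).coeff k = μ.coeff k + ν.coeff k :=
  coeff_unique (by rw [add_mul, mul_toMT_char, mul_toMT_char, add_smul])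

theorem coeff_smul (c : ℂ) (μ : MT) (k : ℤ) : (c • μ).coeff k = c * μ.coeff k :=
  coeff_unique (by rw [smul_mul_assoc, mul_toMT_char, mul_smul])

theorem coeff_mul (μ ν : MT) (k : ℤ) : (μ * ν).coeff k = μ.coeff k * ν.coeff k :=
  coeff_unique (by
    rw [mul_assoc, mul_toMT_char, mul_smul_comm, mul_toMT_char, smul_smul, mul_comm])

theorem norm_coeff_le (μ : MT) (k : ℤ) : ‖μ.coeff k‖ ≤ ‖μ‖ := by
  have h := norm_mul_le μ (char k).toMT
  rw [mul_toMT_char, norm_smul, norm_toMT, norm_char, mul_one, mul_one] at h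
  exact h

/-- The `k`-th Fourier–Stieltjes coefficient as a linear functional. -/
def coeffₗ (k : ℤ) : MT →ₗ[ℂ] ℂ where
  toFun μ := μ.coeff k
  map_add' μ ν := coeff_add μ ν k
  map_smul' c μ := coeff_smul c μ k

theorem coeffₗ_apply (k : ℤ) (μ : MT) : coeffₗ k μ = μ.coeff k := rfl

theorem continuous_coeff (k : ℤ) : Continuous fun μ : MT => μ.coeff k :=
  AddMonoidHomClass.continuous_of_bound (coeffₗ k) 1 fun μ => by
    rw [one_mul]; exact norm_coeff_le μ k

theorem ext_coeff {μ ν : MT} (h : ∀ k, μ.coeff k = ν.coeff k) : μ = ν := by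
  rw [← sub_eq_zero]
  refine eq_zero_of_coeff_eq_zero fun k => ?_
  rw [← coeffₗ_apply, map_sub, coeffₗ_apply, coeffₗ_apply, h, sub_self]

end MT

open WeakDual L1T

namespace L1T

theorem char_eq_fourierLp (k : ℤ) : char k = (fourierLp 1 k : Lp ℂ 1 (haarAddCircle (T := 1))) :=
  Lp.ext ((fn_char k).trans (coeFn_fourierLp 1 k).symm)

/-- A closed subspace of `L¹(𝕋)` containing all exponentials is everything. -/
theorem eq_top_of_char_mem {S : Submodule ℂ L1T} (hS : IsClosed (S : Set L1T))
    (h : ∀ k, char k ∈ S) : S = ⊤ := by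
  have hle : (Submodule.span ℂ (range char)).topologicalClosure ≤ S :=
    Submodule.topologicalClosure_minimal _ (Submodule.span_le.2 (by rintro _ ⟨k, rfl⟩; exact h k)) hS
  have htop : (Submodule.span ℂ (range char)).topologicalClosure = ⊤ := by
    have := span_fourierLp_closure_eq_top (T := 1) (p := 1) (by simp)
    have hr : char = fourierLp (T := 1) 1 := funext char_eq_fourierLp
    rw [hr]
    exact this
  exact top_unique (htop ▸ hle)

/-- The inclusion of `L¹(𝕋)` into `M(𝕋)` as a homomorphism of algebras. -/
def toMTₐ : L1T →ₙₐ[ℂ] MT where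
  toFun := toMT
  map_smul' := toMT_smul
  map_zero' := toMT_zero
  map_add' := toMT_add
  map_mul' := toMT_mul

theorem toMTₐ_apply (f : L1T) : toMTₐ f = f.toMT := rfl

theorem isometry_toMT : Isometry toMT :=
  AddMonoidHomClass.isometry_of_norm toMTₐ norm_toMT

theorem isClosed_range_toMT : IsClosed (range toMT) :=
  isometry_toMT.isClosedEmbedding.isClosed_range

theorem exists_mul_toMT (ν : MT) (f : L1T) : ∃ g : L1T, toMTₐ g = ν * toMTₐ f :=
  idealMT.mul_mem_left ν ⟨f, rfl⟩

end L1T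

/-! ### Characters of an ideal `R` of `M(𝕋)`, embedded isometrically by `ι` and containing the
exponentials `e k`. -/

section IdealOfMeasures

variable {R : Type*} [NonUnitalNormedCommRing R] [NormedSpace ℂ R] {ι : R →ₙₐ[ℂ] MT}

/-- Multiplicative linear functionals on a norm-closed ideal of `M(𝕋)` are contractive. -/
theorem norm_apply_le_of_ideal (hι : ∀ x, ‖ι x‖ = ‖x‖) (hid : ∀ ν x, ∃ y, ι y = ν * ι x)
    (φ : R →ₙₐ[ℂ] ℂ) (x : R) : ‖φ x‖ ≤ ‖x‖ := by
  by_contra! hlt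
  have h0 : φ x ≠ 0 := norm_pos_iff.1 ((norm_nonneg x).trans_lt hlt)
  have hinj : Function.Injective ι := (AddMonoidHomClass.isometry_of_norm ι hι).injective
  set y := (φ x)⁻¹ • x with hy
  have hφy : φ y = 1 := by rw [hy, map_smul, smul_eq_mul, inv_mul_cancel₀ h0]
  have hny : ‖ι y‖ < 1 := by
    rw [hι, hy, norm_smul, norm_inv, inv_mul_lt_one₀ (norm_pos_iff.2 h0)]
    exact hlt
  -- Here `z = (1 - y)⁻¹ y`. The inverse exists only in `M(𝕋)`, but `z` lies in the ideal. Applying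
  -- `φ` to `z = y + y z` gives `φ z = 1 + φ z`.
  obtain ⟨z, hz⟩ := hid ((Units.oneSub (ι y) hny)⁻¹ : MTˣ) y
  have hinv : ((Units.oneSub (ι y) hny)⁻¹ : MTˣ) * (1 - ι y) = 1 :=
    (Units.oneSub (ι y) hny).inv_mul
  have hzy : z = y + y * z := by
    apply hinj
    rw [map_add, map_mul, hz]
    linear_combination ι y * hinv
  have := congrArg φ hzy
  rw [map_add, map_mul, hφy, one_mul] at this
  simp at this

variable {e : ℤ → R}

theorem ne_zero_of_apply_eq_char (he : ∀ k, ι (e k) = (char k).toMT) (k : ℤ) : e k ≠ 0 := by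
  intro h
  have := he k
  rw [h, map_zero] at this
  exact toMT_char_ne_zero k this.symm

theorem mul_eq_coeff_smul (he : ∀ k, ι (e k) = (char k).toMT)
    (hι : ∀ x, ‖ι x‖ = ‖x‖) (x : R) (k : ℤ) :
    x * e k = (ι x).coeff k • e k := by
  apply (AddMonoidHomClass.isometry_of_norm ι hι).injective
  rw [map_mul, he, map_smul, he, mul_toMT_char]

/-- Apply `φ` to `x * e k = x̂(k) e k` and cancel `φ (e k)`. -/
theorem apply_eq_coeff (he : ∀ k, ι (e k) = (char k).toMT) (hι : ∀ x, ‖ι x‖ = ‖x‖)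
    {φ : R →ₙₐ[ℂ] ℂ} {k : ℤ} (h : φ (e k) ≠ 0) (x : R) :
    φ x = (ι x).coeff k := by
  have := congrArg φ (mul_eq_coeff_smul he hι x k)
  rw [map_mul, map_smul, smul_eq_mul] at this
  exact mul_right_cancel₀ h this

theorem exists_coeff_ne_zero (hι : ∀ x, ‖ι x‖ = ‖x‖) {x : R} (hx : x ≠ 0) : ∃ k, (ι x).coeff k ≠ 0 := by
  by_contra! h
  apply hx
  apply (AddMonoidHomClass.isometry_of_norm ι hι).injective
  rw [map_zero]
  exact MT.eq_zero_of_coeff_eq_zero h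

/-- The `k`-th Fourier–Stieltjes coefficient as a character. -/
def coeffChar (he : ∀ k, ι (e k) = (char k).toMT) (hι : ∀ x, ‖ι x‖ = ‖x‖) (k : ℤ) :
    characterSpace ℂ R :=
  ⟨StrongDual.toWeakDual (((MT.coeffₗ k).comp (ι : R →ₗ[ℂ] MT)).mkContinuous 1 fun x => by
    rw [one_mul, ← hι x]
    exact MT.norm_coeff_le (ι x) k), by
    constructor
    · intro h
      have := DFunLike.congr_fun h (e k)
      have h1 : (ι (e k)).coeff k = 0 := this
      rw [he, coeff_char] at h1
      simp at h1
    · intro x y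
      change (ι (x * y)).coeff k = (ι x).coeff k * (ι y).coeff k
      rw [map_mul, MT.coeff_mul]⟩

theorem coeffChar_apply (he : ∀ k, ι (e k) = (char k).toMT) (hι : ∀ x, ‖ι x‖ = ‖x‖)
    (k : ℤ) (x : R) : coeffChar he hι k x = (ι x).coeff k := rfl

theorem isGelfandSemisimple_of_coeff (he : ∀ k, ι (e k) = (char k).toMT)
    (hι : ∀ x, ‖ι x‖ = ‖x‖) : IsGelfandSemisimple R := fun x hx => by
  obtain ⟨k, hk⟩ := exists_coeff_ne_zero hι hx
  exact ⟨coeffChar he hι k, hk⟩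

/-- If every character is nonzero at some exponential, then `ℤ` is the Gelfand space. -/
theorem exists_homeomorph_characterSpace (he : ∀ k, ι (e k) = (char k).toMT)
    (hι : ∀ x, ‖ι x‖ = ‖x‖) (h : ∀ φ : characterSpace ℂ R, ∃ k, φ (e k) ≠ 0) :
    ∃ E : ℤ ≃ₜ characterSpace ℂ R, ∀ k x, E k x = (ι x).coeff k := by
  have hval : ∀ k j, coeffChar he hι k (e j) = if k = j then 1 else 0 := fun k j => by
    rw [coeffChar_apply, he, coeff_char]
  have hbij : Function.Bijective (coeffChar he hι) := by
    constructor
    · intro k j hkj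
      have := hval k j
      rw [hkj, hval j j] at this
      by_contra hne
      simp [hne] at this
    · intro φ
      obtain ⟨k, hk⟩ := h φ
      refine ⟨k, CharacterSpace.ext fun x => ?_⟩
      exact (apply_eq_coeff he hι (φ := CharacterSpace.toNonUnitalAlgHom φ) hk x).symm
  -- The Gelfand space is discrete: evaluation at `e k` is weak* continuous and is nonzero at the
  -- `k`-th character only.
  have hopen : IsOpenMap (coeffChar he hι) := by
    have hpt : ∀ k, IsOpen {coeffChar he hι k} := by
      intro k
      have hc : Continuous fun φ : characterSpace ℂ R => φ (e k) :=
        (WeakDual.eval_continuous (e k)).comp continuous_subtype_val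
      have : {coeffChar he hι k} = (fun φ : characterSpace ℂ R => φ (e k)) ⁻¹' {0}ᶜ := by
        ext φ
        obtain ⟨j, rfl⟩ := hbij.2 φ
        simp only [mem_singleton_iff, mem_preimage, mem_compl_iff, hval, hbij.1.eq_iff]
        simp
      rw [this]
      exact isOpen_compl_singleton.preimage hc
    intro s _
    rw [← biUnion_of_singleton s, image_iUnion₂]
    simp only [image_singleton]
    exact isOpen_biUnion fun k _ => hpt k
  exact ⟨(Equiv.ofBijective _ hbij).toHomeomorphOfContinuousOpen continuous_of_discreteTopology
    hopen, fun k x => rfl⟩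

end IdealOfMeasures

/-! ### The characters of `A` and of `L¹(𝕋)`. -/

theorem mul_mem_algA (ν : MT) {μ : MT} (hμ : μ ∈ algA) : ν * μ ∈ algA := by
  change ν * μ ∈ closure rootsL1
  change μ ∈ closure rootsL1 at hμ
  rw [rootsL1_eq] at *
  exact L1T.idealMT.radical.closure.mul_mem_left ν hμ

theorem rootsL1_subset_algA {μ : MT} (hμ : μ ∈ rootsL1) : μ ∈ algA := subset_closure hμ

/-- The inclusion of `L¹(𝕋)` into the closure of `r(L¹(𝕋))`. -/
def toAlgA : L1T →ₙₐ[ℂ] algA :=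
  NonUnitalAlgHom.codRestrict toMTₐ algA fun f =>
    rootsL1_subset_algA ⟨1, le_rfl, f, (pow_one _).symm⟩

theorem coe_toAlgA (f : L1T) : (toAlgA f : MT) = f.toMT := rfl

/-- The inclusion of the closure of `r(L¹(𝕋))` into `M(𝕋)`. -/
def algA.incl : algA →ₙₐ[ℂ] MT := NonUnitalSubalgebraClass.subtype algA

theorem algA.norm_incl (x : algA) : ‖algA.incl x‖ = ‖x‖ := rfl

theorem norm_toAlgA (f : L1T) : ‖toAlgA f‖ = ‖f‖ := norm_toMT f

theorem algA.incl_char (k : ℤ) : algA.incl (toAlgA (char k)) = (char k).toMT := rfl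

theorem algA.exists_mul (ν : MT) (x : algA) : ∃ y, algA.incl y = ν * algA.incl x :=
  ⟨⟨ν * x, mul_mem_algA ν x.2⟩, rfl⟩

instance : CompleteSpace algA :=
  (isClosed_closure : IsClosed (closure rootsL1)).completeSpace_coe

/-- A character of the closure of `r(L¹(𝕋))` vanishing on `L¹(𝕋)` is zero. -/
theorem eq_zero_of_comp_toAlgA (φ : algA →ₙₐ[ℂ] ℂ) (h : ∀ f, φ (toAlgA f) = 0) : φ = 0 := by
  have hroot : ∀ x : algA, (x : MT) ∈ rootsL1 → φ x = 0 := by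
    rintro x ⟨n, hn, f, hf⟩
    -- `algA` is treated as a nonunital algebra, so powers are formed in `M(𝕋)` and exponents start
    -- at one.
    have hpow : ∀ n : ℕ, ∃ y : algA, (y : MT) = (x : MT) ^ (n + 1) ∧ φ y = φ x ^ (n + 1) := by
      intro n
      induction n with
      | zero => exact ⟨x, by simp, by simp⟩
      | succ n ih =>
        obtain ⟨y, hy, hy'⟩ := ih
        exact ⟨y * x, by rw [pow_succ, ← hy]; rfl, by rw [map_mul, hy', ← pow_succ]⟩
    obtain ⟨n, rfl⟩ : ∃ m, n = m + 1 := ⟨n - 1, by omega⟩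
    obtain ⟨y, hy, hy'⟩ := hpow n
    have : y = toAlgA f := Subtype.ext (hy.trans hf.symm)
    rw [this, h f] at hy'
    exact pow_eq_zero_iff (Nat.succ_ne_zero n) |>.1 hy'.symm
  ext x
  rw [NonUnitalAlgHom.zero_apply, ← norm_le_zero_iff]
  refine le_of_forall_pos_le_add fun ε hε => ?_
  obtain ⟨y, hy, hxy⟩ := Metric.mem_closure_iff.1 (show (x : MT) ∈ closure rootsL1 from x.2) ε hε
  let y' : algA := ⟨y, rootsL1_subset_algA hy⟩
  have h1 : φ x = φ (x - y') := by rw [map_sub, hroot y' hy, sub_zero]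
  rw [zero_add, h1]
  -- Continuity of `φ` is not assumed; automatic contractivity carries the vanishing from the roots
  -- to their closure.
  refine (norm_apply_le_of_ideal (ι := algA.incl) algA.norm_incl algA.exists_mul φ _).trans ?_
  rw [dist_eq_norm] at hxy
  exact hxy.le

theorem exists_char_ne_zero {φ : L1T →ₙₐ[ℂ] ℂ} (hφ : φ ≠ 0) : ∃ k, φ (char k) ≠ 0 := by
  by_contra! h
  apply hφ
  have hc : Continuous φ := AddMonoidHomClass.continuous_of_bound φ 1 fun x => by
    rw [one_mul]; exact norm_apply_le_of_ideal (ι := toMTₐ) norm_toMT exists_mul_toMT φ x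
  let Λ : L1T →ₗ[ℂ] ℂ := φ
  have hker : LinearMap.ker Λ = ⊤ :=
    eq_top_of_char_mem (isClosed_singleton.preimage hc) fun k => h k
  ext f
  have hf : f ∈ LinearMap.ker Λ := hker ▸ Submodule.mem_top
  exact hf

theorem characterSpace_toNonUnitalAlgHom_ne_zero {R : Type*} [NonUnitalNormedCommRing R]
    [NormedSpace ℂ R] (φ : characterSpace ℂ R) : CharacterSpace.toNonUnitalAlgHom φ ≠ 0 := by
  intro h
  exact φ.2.1 (DFunLike.ext _ _ fun x => DFunLike.congr_fun h x)

theorem L1T.exists_characterSpace_char_ne_zero (φ : characterSpace ℂ L1T) :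
    ∃ k, φ (char k) ≠ 0 :=
  exists_char_ne_zero (characterSpace_toNonUnitalAlgHom_ne_zero φ)

theorem algA.exists_characterSpace_char_ne_zero (φ : characterSpace ℂ algA) :
    ∃ k, φ (toAlgA (char k)) ≠ 0 := by
  refine exists_char_ne_zero (φ := (CharacterSpace.toNonUnitalAlgHom φ).comp toAlgA) fun h => ?_
  exact characterSpace_toNonUnitalAlgHom_ne_zero φ
    (eq_zero_of_comp_toAlgA _ fun f => DFunLike.congr_fun h f)

theorem isClosed_idealL1 : IsClosed idealL1.carrier :=
  isClosed_range_toMT.preimage continuous_subtype_val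

/-! ### Radical and non-radical quotients. -/

namespace AlgIdeal

variable {R : Type*} [NonUnitalCommRing R] [Module ℂ R] (I : AlgIdeal R)

/-- The quotient map as a homomorphism of algebras. -/
def cosetₐ : R →ₙₐ[ℂ] I.Quotient where
  toFun := I.coset
  map_smul' _ _ := rfl
  map_zero' := rfl
  map_add' _ _ := rfl
  map_mul' _ _ := rfl

theorem cosetₐ_eq_zero {x : R} (hx : x ∈ I.carrier) : I.cosetₐ x = 0 :=
  (Submodule.Quotient.mk_eq_zero I.toSubmodule).2 hx

/-- A homomorphism that vanishes on an ideal descends to the quotient. -/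
def lift (φ : R →ₙₐ[ℂ] ℂ)
    (h : ∀ x ∈ I.carrier, φ x = 0) : I.Quotient →ₙₐ[ℂ] ℂ where
  toFun := I.toSubmodule.liftQ (φ : R →ₗ[ℂ] ℂ) h
  map_smul' c x := map_smul (I.toSubmodule.liftQ (φ : R →ₗ[ℂ] ℂ) h) c x
  map_zero' := map_zero (I.toSubmodule.liftQ (φ : R →ₗ[ℂ] ℂ) h)
  map_add' x y := map_add (I.toSubmodule.liftQ (φ : R →ₗ[ℂ] ℂ) h) x y
  map_mul' x y := by
    obtain ⟨x, rfl⟩ := I.coset_surjective x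
    obtain ⟨y, rfl⟩ := I.coset_surjective y
    exact map_mul φ x y

end AlgIdeal

theorem isRadicalAlgebra_quotient_idealL1 : IsRadicalAlgebra idealL1.Quotient := by
  intro φ
  have h := eq_zero_of_comp_toAlgA (φ.comp idealL1.cosetₐ) fun f => by
    have : idealL1.cosetₐ (toAlgA f) = 0 := idealL1.cosetₐ_eq_zero ⟨f, rfl⟩
    rw [NonUnitalAlgHom.comp_apply, this, map_zero]
  ext x
  obtain ⟨x, rfl⟩ := idealL1.coset_surjective x
  exact DFunLike.congr_fun h x

theorem not_isRadicalAlgebra_quotient_L1T (I : AlgIdeal L1T) (hI : IsClosed I.carrier)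
    (htop : I.toSubmodule ≠ ⊤) : ¬ IsRadicalAlgebra I.Quotient := by
  intro hrad
  obtain ⟨k, hk⟩ : ∃ k, char k ∉ I.toSubmodule := by
    by_contra! h
    exact htop (eq_top_of_char_mem hI h)
  let φ : L1T →ₙₐ[ℂ] ℂ := CharacterSpace.toNonUnitalAlgHom
    (coeffChar (ι := toMTₐ) (e := char) (fun k => rfl) norm_toMT k)
  have hφ : ∀ f, φ f = f.toMT.coeff k := fun f => rfl
  -- The `k`-th coefficient kills `I`: if `f ∈ I` had `f̂(k) ≠ 0`, then `char k * f = f̂(k) char k`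
  -- would put `char k` in `I`.
  have hz := hrad (I.lift φ fun f hf => by
    by_contra hne
    have h1 := I.mul_mem' (char k) hf
    rw [mul_comm, mul_char, ← coeff_toMT, ← hφ] at h1
    exact hk ((I.toSubmodule.smul_mem_iff hne).1 h1))
  have h1 : φ (char k) = 0 := DFunLike.congr_fun hz (I.coset (char k))
  rw [hφ, coeff_char] at h1
  simp at h1

/-! ### Non-isomorphism by automatic continuity. -/

/-- If `L¹(𝕋)` is a proper ideal of `A`, then `A` is not isomorphic to `L¹(𝕋)`. -/
theorem not_exists_bijective (hne : idealL1.toSubmodule ≠ ⊤) :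
    ¬ ∃ T : algA →ₙₐ[ℂ] L1T, Function.Bijective T := by
  rintro ⟨T, hT⟩
  let S : L1T →ₗ[ℂ] algA := (LinearEquiv.ofBijective (T : algA →ₗ[ℂ] L1T) hT).symm
  have hTS : ∀ f, T (S f) = f := fun f =>
    (LinearEquiv.ofBijective (T : algA →ₗ[ℂ] L1T) hT).apply_symm_apply f
  have hST : ∀ x, S (T x) = x := fun x => hT.1 (hTS _)
  have hSmul : ∀ f g, S (f * g) = S f * S g := fun f g => hT.1 (by rw [hTS, map_mul T, hTS, hTS])
  -- Closed graph theorem: each coefficient of `S f` is a multiplicative functional of `f ∈ L¹`,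
  -- hence continuous, and the coefficients determine the limit.
  have hScont : Continuous S := by
    refine S.continuous_of_seq_closed_graph fun u f x hu hx => ?_
    refine Subtype.ext (MT.ext_coeff fun k => ?_)
    let ψ : L1T →ₙₐ[ℂ] ℂ :=
      { toFun := fun f => (S f : MT).coeff k
        map_smul' := fun c f => by
          rw [map_smul]; exact MT.coeff_smul c _ k
        map_zero' := by
          rw [map_zero]; exact map_zero (MT.coeffₗ k)
        map_add' := fun f g => by
          rw [map_add]; exact MT.coeff_add _ _ k
        map_mul' := fun f g => by
          rw [hSmul]; exact MT.coeff_mul _ _ k }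
    have hψ : Continuous ψ := AddMonoidHomClass.continuous_of_bound ψ 1 fun f => by
      rw [one_mul]; exact norm_apply_le_of_ideal (ι := toMTₐ) norm_toMT exists_mul_toMT ψ f
    have h1 := (hψ.tendsto f).comp hu
    have h2 := (((MT.continuous_coeff k).comp continuous_subtype_val).tendsto x).comp hx
    exact tendsto_nhds_unique h2 h1
  have htop : idealL1.toSubmodule.comap S = ⊤ := by
    refine eq_top_of_char_mem (isClosed_idealL1.preimage hScont) fun j => ?_
    have h0 : S (char j) ≠ 0 := fun h => char_ne_zero j (by rw [← hTS (char j), h, map_zero])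
    obtain ⟨k, hk⟩ := exists_coeff_ne_zero (ι := algA.incl) algA.norm_incl h0
    have h1 := mul_eq_coeff_smul algA.incl_char algA.norm_incl (S (char j)) k
    -- The product is computed twice, `e_k` being an eigenvector in `A` and `char j` in `L¹`. Hence
    -- `S (char j)` is proportional to `e_k`, with both scalars nonzero.
    have h2 : S (char j) * toAlgA (char k) =
        fourierCoeff (T (toAlgA (char k))).fn j • S (char j) := by
      rw [← map_smul, ← mul_char, mul_comm _ (char j), hSmul, hST]
    rw [h1] at h2
    have hc : fourierCoeff (T (toAlgA (char k))).fn j ≠ 0 := by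
      intro hc
      rw [hc, zero_smul, smul_eq_zero] at h2
      exact h2.elim hk (ne_zero_of_apply_eq_char algA.incl_char k)
    refine (idealL1.toSubmodule.smul_mem_iff hc).1 ?_
    rw [← h2]
    exact idealL1.toSubmodule.smul_mem _ ⟨char k, rfl⟩
  apply hne
  refine top_unique fun x _ => ?_
  rw [← hST x]
  exact (htop ▸ Submodule.mem_top : T x ∈ idealL1.toSubmodule.comap S)

/-! ### Equality of the Nevanlinna–Pick norms. -/

theorem L1T.norm_mk (g : UnitAddCircle → ℂ) (hg : Integrable g (haarAddCircle (T := 1))) :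
    ‖mk g hg‖ = ∫ x, ‖g x‖ ∂(haarAddCircle (T := 1)) :=
  L1.norm_of_fun_eq_integral_norm hg

/-- `L¹(𝕋)` contains functions of norm at most one whose Fourier coefficients are close to one at
prescribed places. -/
theorem exists_norm_le_one_coeff_near_one {n : ℕ} (k : Fin n → ℤ) {ε : ℝ} (hε : 0 < ε) :
    ∃ K : L1T, ‖K‖ ≤ 1 ∧ ∀ i, ‖K.toMT.coeff (k i) - 1‖ ≤ ε := by
  -- On this neighbourhood of `0` all the relevant exponentials are close to one; `K` is its
  -- indicator divided by its Haar mass.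
  let U : Set UnitAddCircle := ⋂ i, {x | ‖fourier (-k i) x - 1‖ < ε}
  have hU : IsOpen U := isOpen_iInter_of_finite fun i =>
    isOpen_lt (((fourier (-k i)).continuous.sub continuous_const).norm) continuous_const
  have h0 : (0 : UnitAddCircle) ∈ U := mem_iInter.2 fun i => by
    simpa [fourier_eval_zero] using hε
  have hpos : 0 < (haarAddCircle (T := 1)).real U :=
    ENNReal.toReal_pos (hU.measure_pos _ ⟨0, h0⟩).ne' (measure_ne_top _ _)
  set m := (haarAddCircle (T := 1)).real U with hm
  have hint : Integrable (U.indicator fun _ => ((m⁻¹ : ℝ) : ℂ)) (haarAddCircle (T := 1)) :=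
    (integrable_const _).indicator hU.measurableSet
  have hconst : ∀ c : ℝ, ∫ x, U.indicator (fun _ => m⁻¹ * c) x ∂(haarAddCircle (T := 1)) = c := by
    intro c
    rw [integral_indicator_const _ hU.measurableSet, ← hm, smul_eq_mul, mul_inv_cancel_left₀ hpos.ne']
  refine ⟨mk _ hint, ?_, fun i => ?_⟩
  · rw [norm_mk]
    refine le_of_eq (Eq.trans ?_ (hconst 1))
    refine integral_congr_ae (Filter.Eventually.of_forall fun x => ?_)
    by_cases hx : x ∈ U <;> simp [hx, hpos.le]
  · rw [coeff_toMT, fourierCoeff_congr_ae (fn_mk _ hint), fourierCoeff]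
    have h1 : (1 : ℂ) = ∫ x, U.indicator (fun _ => ((m⁻¹ : ℝ) : ℂ)) x ∂(haarAddCircle (T := 1)) := by
      rw [integral_indicator_const _ hU.measurableSet, ← hm, Complex.real_smul, ← Complex.ofReal_mul,
        mul_inv_cancel₀ hpos.ne', Complex.ofReal_one]
    have hle : ∀ x, ‖fourier (-k i) x • U.indicator (fun _ => ((m⁻¹ : ℝ) : ℂ)) x -
        U.indicator (fun _ => ((m⁻¹ : ℝ) : ℂ)) x‖ ≤ U.indicator (fun _ => m⁻¹ * ε) x := by
      intro x
      by_cases hx : x ∈ U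
      · simp only [hx, indicator_of_mem, smul_eq_mul]
        rw [← sub_one_mul, norm_mul, mul_comm, Complex.norm_real, Real.norm_of_nonneg (by positivity)]
        exact mul_le_mul_of_nonneg_left (mem_iInter.1 hx i).le (by positivity)
      · simp [hx]
    rw [h1, ← integral_sub (hint.fourier_smul _) hint]
    refine (norm_integral_le_of_norm_le ((integrable_const _).indicator hU.measurableSet)
      (Filter.Eventually.of_forall hle)).trans (hconst ε).le

/-- Finitely many Fourier coefficients of a measure can be interpolated in `L¹(𝕋)` at almost no
cost. -/
theorem exists_L1T_coeff_eq {n : ℕ} {k : Fin n → ℤ} (hk : Function.Injective k) (μ : MT) {ε : ℝ}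
    (hε : 0 < ε) :
    ∃ f : L1T, (∀ i, f.toMT.coeff (k i) = μ.coeff (k i)) ∧ ‖f‖ ≤ ‖μ‖ + ε := by
  -- Each of the `n` coefficients will be off by at most `‖μ‖` times this tolerance, so the
  -- correction costs at most `ε`; the `+ 1` keeps the denominator positive.
  obtain ⟨K, hK, hKi⟩ := exists_norm_le_one_coeff_near_one k
    (show 0 < ε / (n * ‖μ‖ + 1) by positivity)
  obtain ⟨g, hg⟩ := exists_mul_toMT μ K
  rw [toMTₐ_apply, toMTₐ_apply] at hg
  have hgn : ‖g‖ ≤ ‖μ‖ := by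
    rw [← norm_toMT, hg]
    refine (norm_mul_le _ _).trans ?_
    rw [norm_toMT]
    exact mul_le_of_le_one_right (norm_nonneg _) hK
  let d : Fin n → ℂ := fun i => μ.coeff (k i) - g.toMT.coeff (k i)
  have hd : ∀ i, ‖d i‖ ≤ ‖μ‖ * (ε / (n * ‖μ‖ + 1)) := fun i => by
    have : d i = μ.coeff (k i) * (1 - K.toMT.coeff (k i)) := by
      simp only [d, hg, MT.coeff_mul]; ring
    rw [this, norm_mul, norm_sub_rev]
    exact mul_le_mul (MT.norm_coeff_le _ _) (hKi i) (norm_nonneg _) (norm_nonneg _)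
  refine ⟨g + ∑ i, d i • char (k i), fun i => ?_, ?_⟩
  · rw [toMT_add, MT.coeff_add, ← toMTₐ_apply (∑ i, d i • char (k i)), ← MT.coeffₗ_apply _ (toMTₐ _),
      map_sum, map_sum, Finset.sum_eq_single i]
    · rw [toMTₐ_apply, toMT_smul, MT.coeffₗ_apply, MT.coeff_smul, coeff_char]
      simp [d]
    · intro j _ hj
      rw [toMTₐ_apply, toMT_smul, MT.coeffₗ_apply, MT.coeff_smul, coeff_char,
        if_neg (hk.ne hj.symm), mul_zero]
    · simp
  · refine (norm_add_le _ _).trans (add_le_add hgn ?_)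
    calc ‖∑ i, d i • char (k i)‖ ≤ ∑ i, ‖d i • char (k i)‖ := norm_sum_le _ _
      _ ≤ ∑ _i : Fin n, ‖μ‖ * (ε / (n * ‖μ‖ + 1)) := Finset.sum_le_sum fun i _ => by
          rw [norm_smul, norm_char, mul_one]; exact hd i
      _ = ε * ((n * ‖μ‖) / (n * ‖μ‖ + 1)) := by
          simp only [Finset.sum_const, Finset.card_univ, Fintype.card_fin, nsmul_eq_mul]; ring
      _ ≤ ε := mul_le_of_le_one_right hε.le ((div_le_one (by positivity)).2 (by linarith))

/-- The isometric inclusion of `L¹` into `A` gives `≤`; interpolating a measure by `L¹` functions at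
cost `ε` gives `≥`. -/
theorem npNorm_algA_eq_npNorm_L1T {eA : ℤ → characterSpace ℂ algA}
    {eB : ℤ → characterSpace ℂ L1T} (hA : ∀ k (μ : algA), eA k μ = (μ : MT).coeff k)
    (hB : ∀ k (f : L1T), eB k f = f.toMT.coeff k) {n : ℕ} {k : Fin n → ℤ}
    (hk : Function.Injective k) (a : Fin n → ℂ) :
    npNorm (fun i => eA (k i)) a = npNorm (fun i => eB (k i)) a := by
  -- A nonempty set of competitors is needed because the real infimum of the empty set is `0` by
  -- convention.
  have hne : ∃ f : L1T, ∀ i, eB (k i) f = a i := by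
    refine ⟨∑ i, a i • char (k i), fun i => ?_⟩
    rw [map_sum, Finset.sum_eq_single i]
    · rw [map_smul, hB, coeff_char]; simp
    · intro j _ hj
      rw [map_smul, hB, coeff_char, if_neg (hk.ne hj.symm), smul_zero]
    · simp
  have hsub : ∀ f : L1T, (∀ i, eB (k i) f = a i) → ∀ i, eA (k i) (toAlgA f) = a i :=
    fun f hf i => by rw [hA, ← hf i, hB, coe_toAlgA]
  obtain ⟨f₀, hf₀⟩ := hne
  refine le_antisymm ?_ ?_
  · refine le_csInf ⟨_, f₀, hf₀, rfl⟩ ?_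
    rintro _ ⟨f, hf, rfl⟩
    exact csInf_le ⟨0, by rintro _ ⟨x, _, rfl⟩; exact norm_nonneg x⟩
      ⟨toAlgA f, hsub f hf, (norm_toAlgA f).symm⟩
  · refine le_csInf ⟨_, toAlgA f₀, hsub f₀ hf₀, rfl⟩ ?_
    rintro _ ⟨x, hx, rfl⟩
    refine le_of_forall_pos_le_add fun ε hε => ?_
    obtain ⟨f, hf, hfn⟩ := exists_L1T_coeff_eq hk (x : MT) hε
    refine le_trans (csInf_le ⟨0, by rintro _ ⟨x, _, rfl⟩; exact norm_nonneg x⟩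
      ⟨f, fun i => ?_, rfl⟩) hfn
    rw [hB, hf, ← hx i, hA]

/-! ### Fourier coefficients of the Riesz product. -/

/-- The amplitudes of the Riesz product. -/
def rieszAmp (n : ℕ) : ℝ := 1 / √(n + 1)

theorem rieszAmp_nonneg (n : ℕ) : 0 ≤ rieszAmp n := by unfold rieszAmp; positivity

theorem rieszAmp_le_one (n : ℕ) : rieszAmp n ≤ 1 := by
  unfold rieszAmp
  rw [div_le_one (by positivity), Real.one_le_sqrt]
  linarith [(Nat.cast_nonneg n : (0 : ℝ) ≤ n)]

theorem rieszAmp_sq (n : ℕ) : rieszAmp n ^ 2 = 1 / (n + 1) := by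
  unfold rieszAmp
  rw [div_pow, Real.sq_sqrt (by positivity), one_pow]

theorem tendsto_sum_rieszAmp_sq :
    Filter.Tendsto (fun n => ∑ j ∈ Finset.range n, rieszAmp j ^ 2) Filter.atTop Filter.atTop := by
  simp_rw [rieszAmp_sq]
  exact Real.tendsto_sum_range_one_div_nat_succ_atTop

/-- The Fourier coefficients of the partial product `∏_{j < n} (1 + a_j cos (2π 3^j x))`. -/
def rieszCoeff : ℕ → ℤ → ℝ
  | 0, k => if k = 0 then 1 else 0
  | n + 1, k => rieszCoeff n k +
      rieszAmp n / 2 * (rieszCoeff n (k - 3 ^ n) + rieszCoeff n (k + 3 ^ n))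

theorem rieszCoeff_zero (k : ℤ) : rieszCoeff 0 k = if k = 0 then 1 else 0 := rfl

theorem rieszCoeff_succ (n : ℕ) (k : ℤ) : rieszCoeff (n + 1) k = rieszCoeff n k +
    rieszAmp n / 2 * (rieszCoeff n (k - 3 ^ n) + rieszCoeff n (k + 3 ^ n)) := rfl

/-- The frequencies of the partial product are `∑ ε_j 3^j` with `ε_j ∈ {-1, 0, 1}` and `j < n`, so
they are at most `(3^n - 1) / 2` in absolute value. -/
theorem rieszCoeff_eq_zero {n : ℕ} {k : ℤ} (h : 3 ^ n ≤ 2 * |k|) : rieszCoeff n k = 0 := by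
  induction n generalizing k with
  | zero =>
    rw [rieszCoeff_zero, if_neg]
    rintro rfl
    simp at h
  | succ n ih =>
    rw [pow_succ] at h
    have h1 := abs_sub_abs_le_abs_sub k (3 ^ n)
    have h2 := abs_sub_abs_le_abs_sub k (-3 ^ n)
    rw [sub_neg_eq_add, abs_neg] at h2
    have h3 : |(3 : ℤ) ^ n| = 3 ^ n := abs_of_nonneg (by positivity)
    have h4 : (0 : ℤ) < 3 ^ n := by positivity
    rw [rieszCoeff_succ, ih (by linarith), ih (by linarith), ih (by linarith)]
    ring

theorem rieszCoeff_succ_of_lt {n : ℕ} {k : ℤ} (h : 2 * |k| < 3 ^ n) :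
    rieszCoeff (n + 1) k = rieszCoeff n k := by
  have h1 := abs_sub_abs_le_abs_sub (3 ^ n) k
  have h2 := abs_sub_abs_le_abs_sub (3 ^ n) (-k)
  rw [sub_neg_eq_add, abs_neg, add_comm] at h2
  rw [abs_sub_comm] at h1
  have h3 : |(3 : ℤ) ^ n| = 3 ^ n := abs_of_nonneg (by positivity)
  rw [rieszCoeff_succ, rieszCoeff_eq_zero (k := k - 3 ^ n) (by linarith),
    rieszCoeff_eq_zero (k := k + 3 ^ n) (by linarith)]
  ring

theorem rieszCoeff_of_le {n m : ℕ} {k : ℤ} (h : 2 * |k| < 3 ^ n) (hnm : n ≤ m) :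
    rieszCoeff m k = rieszCoeff n k := by
  induction m, hnm using Nat.le_induction with
  | base => rfl
  | succ m hnm ih =>
    rw [rieszCoeff_succ_of_lt (h.trans_le (pow_le_pow_right₀ (by norm_num) hnm)), ih]

theorem rieszCoeff_neg (n : ℕ) (k : ℤ) : rieszCoeff n (-k) = rieszCoeff n k := by
  induction n generalizing k with
  | zero => simp [rieszCoeff_zero]
  | succ n ih =>
    rw [rieszCoeff_succ, rieszCoeff_succ, ih, ← ih (k - 3 ^ n), ← ih (k + 3 ^ n)]
    ring_nf

/-- The Fourier coefficients of the infinite Riesz product. -/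
def rieszLim (k : ℤ) : ℝ := rieszCoeff (2 * k.natAbs) k

/-- This places the index chosen in `rieszLim` in the range where the coefficient at `k` no longer
changes. -/
theorem two_mul_abs_lt (k : ℤ) : 2 * |k| < 3 ^ (2 * k.natAbs) := by
  have := Nat.lt_pow_self (n := 2 * k.natAbs) (show 1 < 3 by norm_num)
  zify at this
  exact this

theorem rieszCoeff_eq_rieszLim {n : ℕ} {k : ℤ} (h : 2 * |k| < 3 ^ n) :
    rieszCoeff n k = rieszLim k := by
  rw [← rieszCoeff_of_le h (le_max_left n (2 * k.natAbs)), rieszLim,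
    rieszCoeff_of_le (two_mul_abs_lt k) (le_max_right _ _)]

theorem eventually_rieszCoeff_eq (k : ℤ) :
    ∀ᶠ n in Filter.atTop, rieszCoeff n k = rieszLim k :=
  (Filter.eventually_ge_atTop (2 * k.natAbs)).mono fun _ hn =>
    rieszCoeff_of_le (two_mul_abs_lt k) hn

theorem rieszLim_neg (k : ℤ) : rieszLim (-k) = rieszLim k := by
  rw [rieszLim, rieszLim, Int.natAbs_neg, rieszCoeff_neg]

theorem rieszCoeff_at_zero (n : ℕ) : rieszCoeff n 0 = 1 := by
  rw [rieszCoeff_of_le (n := 0) (by simp) n.zero_le]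
  simp [rieszCoeff_zero]

/-- At stage `n + 1` only the shift of the constant term reaches the frequency `3^n`. -/
theorem rieszLim_pow (n : ℕ) : rieszLim (3 ^ n) = rieszAmp n / 2 := by
  have h4 : (0 : ℤ) < 3 ^ n := by positivity
  have h3 : |(3 : ℤ) ^ n| = 3 ^ n := abs_of_nonneg h4.le
  have h5 : |(3 : ℤ) ^ n + 3 ^ n| = 3 ^ n + 3 ^ n := abs_of_nonneg (by linarith)
  rw [← rieszCoeff_eq_rieszLim (n := n + 1) (by rw [h3, pow_succ]; linarith), rieszCoeff_succ,
    sub_self, rieszCoeff_at_zero, rieszCoeff_eq_zero (k := 3 ^ n) (by rw [h3]; linarith),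
    rieszCoeff_eq_zero (k := 3 ^ n + 3 ^ n) (by rw [h5]; linarith)]
  ring

theorem rieszLim_pow_sub_pow_of_lt {i j : ℕ} (h : j < i) :
    rieszLim (3 ^ i - 3 ^ j) = rieszAmp i / 2 * (rieszAmp j / 2) := by
  have hi : (0 : ℤ) < 3 ^ i := by positivity
  have hj : (0 : ℤ) < 3 ^ j := by positivity
  have hij : 3 * (3 : ℤ) ^ j ≤ 3 ^ i := by
    rw [← pow_succ']
    exact pow_le_pow_right₀ (by norm_num) h
  have h1 : |(3 : ℤ) ^ i - 3 ^ j| = 3 ^ i - 3 ^ j := abs_of_nonneg (by linarith)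
  have h2 : |(3 : ℤ) ^ i - 3 ^ j + 3 ^ i| = 3 ^ i - 3 ^ j + 3 ^ i := abs_of_nonneg (by linarith)
  have h3 : |(3 : ℤ) ^ j| = 3 ^ j := abs_of_nonneg hj.le
  have h4 : (3 : ℤ) ^ i - 3 ^ j - 3 ^ i = -3 ^ j := by ring
  rw [← rieszCoeff_eq_rieszLim (n := i + 1) (by rw [h1, pow_succ]; linarith), rieszCoeff_succ,
    rieszCoeff_eq_zero (k := 3 ^ i - 3 ^ j) (by rw [h1]; linarith),
    rieszCoeff_eq_zero (k := 3 ^ i - 3 ^ j + 3 ^ i) (by rw [h2]; linarith), h4, rieszCoeff_neg,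
    rieszCoeff_eq_rieszLim (by rw [h3]; linarith), rieszLim_pow]
  ring

/-- With `rieszLim_pow`, this says that the exponentials of frequencies `3^i` are uncorrelated under
the Riesz product. -/
theorem rieszLim_pow_sub_pow {i j : ℕ} (h : i ≠ j) :
    rieszLim (3 ^ i - 3 ^ j) = rieszAmp i / 2 * (rieszAmp j / 2) := by
  rcases lt_or_gt_of_ne h with h | h
  · rw [← rieszLim_neg, neg_sub, rieszLim_pow_sub_pow_of_lt h, mul_comm]
  · exact rieszLim_pow_sub_pow_of_lt h

/-- The supports of the three translates in the recursion are disjoint, so no cross terms arise. -/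
theorem rieszCoeff_succ_pow_four (n : ℕ) (k : ℤ) : rieszCoeff (n + 1) k ^ 4 =
    rieszCoeff n k ^ 4 + (rieszAmp n / 2) ^ 4 *
      (rieszCoeff n (k - 3 ^ n) ^ 4 + rieszCoeff n (k + 3 ^ n) ^ 4) := by
  have h3 : |(3 : ℤ) ^ n| = 3 ^ n := abs_of_nonneg (by positivity)
  have hp : (0 : ℤ) < 3 ^ n := by positivity
  by_cases h : 2 * |k| < 3 ^ n
  · have h1 := abs_sub_abs_le_abs_sub (3 ^ n) k
    have h2 := abs_sub_abs_le_abs_sub (3 ^ n) (-k)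
    rw [sub_neg_eq_add, abs_neg, add_comm] at h2
    rw [abs_sub_comm] at h1
    rw [rieszCoeff_succ_of_lt h, rieszCoeff_eq_zero (k := k - 3 ^ n) (by linarith),
      rieszCoeff_eq_zero (k := k + 3 ^ n) (by linarith)]
    ring
  · rw [rieszCoeff_succ, rieszCoeff_eq_zero (not_lt.1 h)]
    rcases le_total 0 k with hk | hk
    · have : |k + 3 ^ n| = k + 3 ^ n := abs_of_nonneg (by linarith)
      rw [rieszCoeff_eq_zero (k := k + 3 ^ n) (by rw [this]; linarith)]
      ring
    · have : |k - 3 ^ n| = -(k - 3 ^ n) := abs_of_nonpos (by linarith)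
      rw [rieszCoeff_eq_zero (k := k - 3 ^ n) (by rw [this]; linarith)]
      ring

/-- Each step multiplies the sum by `1 + a_n ^ 4 / 8 = 1 + 1 / (8 (n + 1) ^ 2)`. The bound `2 - 1 /
(n + 1)` is a form of uniform boundedness that survives the induction. -/
theorem exists_hasSum_rieszCoeff_pow_four (n : ℕ) :
    ∃ S, HasSum (fun k => rieszCoeff n k ^ 4) S ∧ S ≤ 2 - 1 / (n + 1) := by
  induction n with
  | zero =>
    refine ⟨1, ?_, by norm_num⟩
    have h : (fun k => rieszCoeff 0 k ^ 4) = fun k => if k = 0 then 1 else 0 := by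
      funext k
      rw [rieszCoeff_zero]
      split_ifs <;> simp
    rw [h]
    exact hasSum_ite_eq 0 1
  | succ n ih =>
    obtain ⟨S, hS, hle⟩ := ih
    have h1 : HasSum (fun k => rieszCoeff n (k - 3 ^ n) ^ 4) S :=
      (Equiv.hasSum_iff (f := fun k => rieszCoeff n k ^ 4) (Equiv.subRight ((3 : ℤ) ^ n))).2 hS
    have h2 : HasSum (fun k => rieszCoeff n (k + 3 ^ n) ^ 4) S :=
      (Equiv.hasSum_iff (f := fun k => rieszCoeff n k ^ 4) (Equiv.addRight ((3 : ℤ) ^ n))).2 hS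
    have h3 := hS.add ((h1.add h2).mul_left ((rieszAmp n / 2) ^ 4))
    simp_rw [← rieszCoeff_succ_pow_four] at h3
    refine ⟨_, h3, ?_⟩
    have h4 : (rieszAmp n / 2) ^ 4 = (1 / (n + 1)) ^ 2 / 16 := by
      rw [← rieszAmp_sq]; ring
    rw [h4]
    have hx : (1 : ℝ) ≤ n + 1 := by linarith [(Nat.cast_nonneg n : (0 : ℝ) ≤ n)]
    push_cast
    generalize (n : ℝ) + 1 = x at *
    have h5 : S + (1 / x) ^ 2 / 16 * (S + S) ≤
        (2 - 1 / x) * (1 + (1 / x) ^ 2 / 8) := by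
      have : S + (1 / x) ^ 2 / 16 * (S + S) = S * (1 + (1 / x) ^ 2 / 8) := by ring
      rw [this]
      exact mul_le_mul_of_nonneg_right hle (by positivity)
    refine h5.trans ?_
    have h6 : 1 / (x + 1) ≤ 1 / x - (1 / x) ^ 2 / 2 := by
      have : 1 / x - (1 / x) ^ 2 / 2 - 1 / (x + 1) = (x - 1) / (2 * x ^ 2 * (x + 1)) := by
        field_simp
        ring
      have h7 : 0 ≤ (x - 1) / (2 * x ^ 2 * (x + 1)) := div_nonneg (by linarith) (by positivity)
      linarith
    have h7 : 0 ≤ (1 / x) ^ 3 := by positivity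
    have h8 : 0 ≤ (1 / x) ^ 2 := by positivity
    linarith

theorem summable_rieszLim_pow_four : Summable fun k => rieszLim k ^ 4 := by
  refine summable_of_sum_le (c := 2) (fun k => by positivity) fun F => ?_
  have hev : ∀ᶠ n in Filter.atTop, ∀ k ∈ F, rieszCoeff n k = rieszLim k :=
    (Filter.eventually_all_finset F).2 fun k _ => eventually_rieszCoeff_eq k
  obtain ⟨n, hn⟩ := hev.exists
  obtain ⟨S, hS, hle⟩ := exists_hasSum_rieszCoeff_pow_four n
  have hF : ∑ k ∈ F, rieszLim k ^ 4 = ∑ k ∈ F, rieszCoeff n k ^ 4 :=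
    Finset.sum_congr rfl fun k hk => by rw [hn k hk]
  rw [hF]
  refine (sum_le_hasSum F (fun k _ => by positivity) hS).trans (hle.trans ?_)
  have : (0 : ℝ) ≤ 1 / (n + 1) := by positivity
  linarith

/-! ### The Riesz product as a weak limit of probability measures. -/

/-- The partial product `∏_{j < n} (1 + a_j cos (2π 3^j x))`. -/
def rieszProd (n : ℕ) (x : UnitAddCircle) : ℝ :=
  ∏ j ∈ Finset.range n, (1 + rieszAmp j * (fourier (3 ^ j) x).re)

theorem continuous_rieszProd (n : ℕ) : Continuous (rieszProd n) :=
  continuous_finsetProd _ fun j _ =>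
    continuous_const.add (continuous_const.mul
      (Complex.continuous_re.comp (fourier (3 ^ j)).continuous))

theorem rieszProd_nonneg (n : ℕ) (x : UnitAddCircle) : 0 ≤ rieszProd n x := by
  refine Finset.prod_nonneg fun j _ => ?_
  have h1 : |(fourier (3 ^ j) x).re| ≤ 1 :=
    (Complex.abs_re_le_norm _).trans (norm_fourier_apply _ x).le
  have h2 := neg_le_of_abs_le h1
  nlinarith [rieszAmp_nonneg j, rieszAmp_le_one j]

theorem fourierCoeff_rieszProd (n : ℕ) (k : ℤ) :
    fourierCoeff (fun x => (rieszProd n x : ℂ)) k = rieszCoeff n k := by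
  induction n generalizing k with
  | zero =>
    have h := L1T.coeff_char 0 k
    rw [L1T.coeff_toMT, fourierCoeff_congr_ae (L1T.fn_char 0)] at h
    simp only [rieszProd, Finset.range_zero, Finset.prod_empty, Complex.ofReal_one,
      rieszCoeff_zero]
    have h0 : (fun _ : UnitAddCircle => (1 : ℂ)) = fourier 0 := by ext x; simp
    rw [h0, h]
    split_ifs <;> simp
  | succ n ih =>
    have hc : ∀ m : ℤ, Integrable (fun x => fourier m x * (rieszProd n x : ℂ))
        (haarAddCircle (T := 1)) := fun m =>
      integrable_of_continuous ((fourier m).continuous.mul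
        (Complex.continuous_ofReal.comp (continuous_rieszProd n)))
    have hcoe : ∀ m : ℤ, ∫ x, fourier (-m) x * (rieszProd n x : ℂ) ∂(haarAddCircle (T := 1)) =
        rieszCoeff n m := fun m => ih m
    have hpt : ∀ x : UnitAddCircle, fourier (-k) x • (rieszProd (n + 1) x : ℂ) =
        fourier (-k) x * (rieszProd n x : ℂ) + (rieszAmp n / 2 : ℂ) *
          (fourier (-(k - 3 ^ n)) x * (rieszProd n x : ℂ) +
            fourier (-(k + 3 ^ n)) x * (rieszProd n x : ℂ)) := by
      -- The new factor is expanded using `cos θ = (e^{iθ} + e^{-iθ}) / 2`, which produces the two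
      -- shifts by `3^n`.
      intro x
      have hre : ((fourier (3 ^ n) x).re : ℂ) =
          (fourier (3 ^ n) x + fourier (-3 ^ n) x) / 2 := by
        rw [fourier_neg, Complex.re_eq_add_conj]
      rw [neg_sub, neg_add, sub_eq_neg_add, fourier_add, fourier_add, rieszProd,
        Finset.prod_range_succ, ← rieszProd]
      push_cast
      rw [hre, smul_eq_mul]
      ring
    rw [fourierCoeff]
    simp_rw [hpt]
    have hc' : Integrable (fun x => (rieszAmp n / 2 : ℂ) *
        (fourier (-(k - 3 ^ n)) x * (rieszProd n x : ℂ) +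
          fourier (-(k + 3 ^ n)) x * (rieszProd n x : ℂ))) (haarAddCircle (T := 1)) :=
      ((hc _).add (hc _)).const_mul _
    rw [integral_add (hc _) hc', integral_const_mul,
      integral_add (hc _) (hc _), hcoe, hcoe, hcoe, rieszCoeff_succ]
    push_cast
    ring

/-- A probability measure whose Fourier–Stieltjes coefficients are those of the Riesz product. -/
theorem exists_riesz_measure : ∃ ρ : Measure UnitAddCircle, IsProbabilityMeasure ρ ∧
    ∀ k : ℤ, ∫ x, fourier k x ∂ρ = rieszLim k := by
  have hm : ∀ n, Measurable fun x => ENNReal.ofReal (rieszProd n x) := fun n =>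
    (continuous_rieszProd n).measurable.ennreal_ofReal
  let ρ : ℕ → Measure UnitAddCircle := fun n =>
    (haarAddCircle (T := 1)).withDensity fun x => ENNReal.ofReal (rieszProd n x)
  have hcoeff : ∀ n (k : ℤ), ∫ x, fourier (-k) x ∂(ρ n) = rieszCoeff n k := by
    intro n k
    rw [integral_withDensity_eq_integral_toReal_smul (hm n) (by simp), ← fourierCoeff_rieszProd,
      fourierCoeff]
    refine integral_congr_ae (Filter.Eventually.of_forall fun x => ?_)
    simp only [ENNReal.toReal_ofReal (rieszProd_nonneg n x), Complex.real_smul, smul_eq_mul]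
    ring
  have hprob : ∀ n, IsProbabilityMeasure (ρ n) := by
    intro n
    refine ⟨?_⟩
    have hint : Integrable (rieszProd n) (haarAddCircle (T := 1)) :=
      integrable_of_continuous (continuous_rieszProd n)
    have h1 : ∫ x, rieszProd n x ∂(haarAddCircle (T := 1)) = 1 := by
      have := fourierCoeff_rieszProd n 0
      simp only [fourierCoeff, neg_zero, fourier_zero, one_smul, rieszCoeff_at_zero] at this
      rw [← Complex.ofReal_inj, ← this]
      exact integral_ofReal.symm
    rw [withDensity_apply _ MeasurableSet.univ, Measure.restrict_univ,
      ← ofReal_integral_eq_lintegral_ofReal hint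
        (Filter.Eventually.of_forall (rieszProd_nonneg n)), h1, ENNReal.ofReal_one]
  let P : ℕ → ProbabilityMeasure UnitAddCircle := fun n => ⟨ρ n, hprob n⟩
  -- Probability measures on the circle form a compact space, so a limit along a nonprincipal
  -- ultrafilter exists without passing to a subsequence.
  have hlim := ((Filter.hyperfilter ℕ).map P).le_nhds_lim
  set Q := ((Filter.hyperfilter ℕ).map P).lim
  have hPQ : Filter.Tendsto P (Filter.hyperfilter ℕ) (nhds Q) := hlim
  refine ⟨Q, inferInstance, fun k => ?_⟩
  have h1 := (ProbabilityMeasure.tendsto_iff_forall_integral_rclike_tendsto ℂ).1 hPQ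
    (BoundedContinuousFunction.mkOfCompact (fourier (-(-k))))
  have h2 : Filter.Tendsto (fun n => ∫ x, fourier (-(-k)) x ∂(ρ n)) (Filter.hyperfilter ℕ)
      (nhds (rieszLim (-k) : ℂ)) := by
    refine tendsto_const_nhds.congr' ?_
    refine Filter.Eventually.filter_mono Nat.hyperfilter_le_atTop ?_
    filter_upwards [eventually_rieszCoeff_eq (-k)] with n hn
    rw [hcoeff, hn]
  have h3 := tendsto_nhds_unique h1 h2
  rw [rieszLim_neg] at h3
  simpa using h3

/-! ### A weak law of large numbers, and failure of absolute continuity. -/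

section WeakLaw

variable {P : Measure UnitAddCircle} [IsProbabilityMeasure P] {f : ℕ → C(UnitAddCircle, ℂ)}
  {m : ℕ → ℂ}

/-- Off-diagonal covariances vanish, and each variance is `1 - ‖m j‖ ^ 2 ≤ 1`. -/
theorem integral_norm_sq_sum_le (hf : ∀ j x, ‖f j x‖ = 1) (h1 : ∀ j, ∫ x, f j x ∂P = m j)
    (h2 : ∀ i j, i ≠ j → ∫ x, f i x * starRingEnd ℂ (f j x) ∂P = m i * starRingEnd ℂ (m j))
    (a : ℕ → ℝ) (n : ℕ) :
    ∫ x, ‖∑ j ∈ Finset.range n, (a j : ℂ) * (f j x - m j)‖ ^ 2 ∂P ≤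
      ∑ j ∈ Finset.range n, a j ^ 2 := by
  have hcov : ∀ i j, ∫ x, (f i x - m i) * starRingEnd ℂ (f j x - m j) ∂P =
      if i = j then ((1 - ‖m i‖ ^ 2 : ℝ) : ℂ) else 0 := by
    intro i j
    have hconj : ∫ x, starRingEnd ℂ (f j x) ∂P = starRingEnd ℂ (m j) := by
      rw [integral_conj, h1]
    have c1 : Continuous fun x => f i x * starRingEnd ℂ (f j x) :=
      (f i).continuous.mul (Complex.continuous_conj.comp (f j).continuous)
    have c2 : Continuous fun x => f i x * starRingEnd ℂ (m j) :=
      (f i).continuous.mul continuous_const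
    have c3 : Continuous fun x => m i * starRingEnd ℂ (f j x) :=
      continuous_const.mul (Complex.continuous_conj.comp (f j).continuous)
    have he : ∀ x, (f i x - m i) * starRingEnd ℂ (f j x - m j) =
        f i x * starRingEnd ℂ (f j x) - f i x * starRingEnd ℂ (m j) -
          (m i * starRingEnd ℂ (f j x) - m i * starRingEnd ℂ (m j)) := fun x => by
      rw [map_sub]; ring
    have i1 : Integrable (fun x => f i x * starRingEnd ℂ (f j x) - f i x * starRingEnd ℂ (m j)) P :=
      integrable_of_continuous (c1.sub c2)
    have i2 : Integrable (fun x => m i * starRingEnd ℂ (f j x) - m i * starRingEnd ℂ (m j)) P :=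
      integrable_of_continuous (c3.sub continuous_const)
    simp_rw [he]
    rw [integral_sub i1 i2,
      integral_sub (integrable_of_continuous c1) (integrable_of_continuous c2),
      integral_sub (integrable_of_continuous c3) (integrable_const _), integral_mul_const,
      integral_const_mul, hconj, h1]
    simp only [integral_const, probReal_univ, one_smul, sub_self, sub_zero]
    split_ifs with hij
    · subst hij
      have : ∀ x, f i x * starRingEnd ℂ (f i x) = 1 := fun x => by
        rw [Complex.mul_conj, Complex.normSq_eq_norm_sq, hf]; simp
      simp_rw [this]
      rw [Complex.mul_conj, Complex.normSq_eq_norm_sq]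
      simp
    · rw [h2 i j hij, sub_self]
  have key : ((∫ x, ‖∑ j ∈ Finset.range n, (a j : ℂ) * (f j x - m j)‖ ^ 2 ∂P : ℝ) : ℂ) =
      ((∑ j ∈ Finset.range n, a j ^ 2 * (1 - ‖m j‖ ^ 2) : ℝ) : ℂ) := by
    refine integral_ofReal.symm.trans ?_
    have he : ∀ x, ((‖∑ j ∈ Finset.range n, (a j : ℂ) * (f j x - m j)‖ ^ 2 : ℝ) : ℂ) =
        ∑ i ∈ Finset.range n, ∑ j ∈ Finset.range n,
          (a i * a j : ℂ) * ((f i x - m i) * starRingEnd ℂ (f j x - m j)) := by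
      intro x
      rw [← Complex.normSq_eq_norm_sq, ← Complex.mul_conj, map_sum, Finset.sum_mul_sum]
      refine Finset.sum_congr rfl fun i _ => Finset.sum_congr rfl fun j _ => ?_
      rw [map_mul, Complex.conj_ofReal]
      ring
    have hint : ∀ i j, Integrable (fun x =>
        (a i * a j : ℂ) * ((f i x - m i) * starRingEnd ℂ (f j x - m j))) P := fun i j =>
      integrable_of_continuous (continuous_const.mul (((f i).continuous.sub continuous_const).mul
        (Complex.continuous_conj.comp ((f j).continuous.sub continuous_const))))
    refine (integral_congr_ae (Filter.Eventually.of_forall he)).trans ?_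
    rw [integral_finsetSum _ fun i _ => integrable_finsetSum _ fun j _ => hint i j]
    simp_rw [integral_finsetSum _ fun j _ => hint _ j, integral_const_mul, hcov]
    push_cast
    refine Finset.sum_congr rfl fun i hi => ?_
    rw [Finset.sum_eq_single i]
    · rw [if_pos rfl]; ring
    · intro j _ hj
      rw [if_neg hj.symm, mul_zero]
    · exact fun h => absurd hi h
  rw [Complex.ofReal_inj] at key
  rw [key]
  refine Finset.sum_le_sum fun j _ => mul_le_of_le_one_right (sq_nonneg _) ?_
  linarith [sq_nonneg ‖m j‖]

/-- A weak law of large numbers for uncorrelated unimodular functions, along subsequences. -/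
theorem exists_subseq_tendsto_ae (hf : ∀ j x, ‖f j x‖ = 1) (h1 : ∀ j, ∫ x, f j x ∂P = m j)
    (h2 : ∀ i j, i ≠ j → ∫ x, f i x * starRingEnd ℂ (f j x) ∂P = m i * starRingEnd ℂ (m j))
    {a : ℕ → ℝ} (ha : Filter.Tendsto (fun n => ∑ j ∈ Finset.range n, a j ^ 2) Filter.atTop
      Filter.atTop) {ns : ℕ → ℕ} (hns : Filter.Tendsto ns Filter.atTop Filter.atTop) :
    ∃ ms : ℕ → ℕ, StrictMono ms ∧ ∀ᵐ x ∂P, Filter.Tendsto (fun i =>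
      (∑ j ∈ Finset.range (ns (ms i)), (a j : ℂ) * (f j x - m j)) /
        ((∑ j ∈ Finset.range (ns (ms i)), a j ^ 2 : ℝ) : ℂ)) Filter.atTop (nhds 0) := by
  let W : ℕ → UnitAddCircle → ℂ := fun n x =>
    (∑ j ∈ Finset.range n, (a j : ℂ) * (f j x - m j)) /
      ((∑ j ∈ Finset.range n, a j ^ 2 : ℝ) : ℂ)
  have hW : ∀ n, Continuous (W n) := fun n =>
    (continuous_finsetSum _ fun j _ =>
      continuous_const.mul ((f j).continuous.sub continuous_const)).div_const _
  have hnorm : ∀ n, ∫ x, ‖W n x‖ ^ 2 ∂P ≤ (∑ j ∈ Finset.range n, a j ^ 2)⁻¹ := by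
    intro n
    have h0 : 0 ≤ ∑ j ∈ Finset.range n, a j ^ 2 := Finset.sum_nonneg fun j _ => sq_nonneg _
    set S := ∑ j ∈ Finset.range n, a j ^ 2 with hS
    have : ∀ x, ‖W n x‖ ^ 2 =
        ‖∑ j ∈ Finset.range n, (a j : ℂ) * (f j x - m j)‖ ^ 2 * (S ^ 2)⁻¹ := fun x => by
      simp only [W, ← hS, norm_div, div_pow, Complex.norm_real, Real.norm_eq_abs, sq_abs]
      rfl
    simp_rw [this]
    rw [integral_mul_const]
    refine (mul_le_mul_of_nonneg_right (integral_norm_sq_sum_le hf h1 h2 a n)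
      (by positivity)).trans ?_
    rw [← hS]
    -- If `S = 0`, both sides are `0` by the convention for inverses.
    rcases h0.eq_or_lt with h | h
    · simp [← h]
    · rw [sq, mul_inv, mul_inv_cancel_left₀ h.ne']
  have hsq : Filter.Tendsto (fun n => ∫ x, ‖W n x‖ ^ 2 ∂P) Filter.atTop (nhds 0) :=
    squeeze_zero (fun n => integral_nonneg fun x => by positivity) hnorm ha.inv_tendsto_atTop
  have hL : ∀ n, eLpNorm (W n - 0) 2 P =
      ENNReal.ofReal ((∫ x, ‖W n x‖ ^ 2 ∂P) ^ (2⁻¹ : ℝ)) := by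
    intro n
    have hmem : MemLp (W n) 2 P :=
      (BoundedContinuousFunction.mkOfCompact ⟨W n, hW n⟩).memLp_top.mono_exponent le_top
    rw [sub_zero, hmem.eLpNorm_eq_integral_rpow_norm (by simp) (by simp)]
    simp
  -- The second moments of `W n` are at most `1 / ∑ a_j ^ 2`, so there is convergence in `L²`, hence
  -- in measure, hence almost everywhere along a subsequence.
  have hmeas : TendstoInMeasure P (fun i => W (ns i)) Filter.atTop 0 := by
    refine tendstoInMeasure_of_tendsto_eLpNorm (p := 2) (by simp)
      (fun n => (hW _).aestronglyMeasurable) aestronglyMeasurable_const ?_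
    simp_rw [hL]
    have h3 := ((hsq.comp hns).rpow_const (p := (2⁻¹ : ℝ)) (Or.inr (by norm_num)))
    rw [Real.zero_rpow (by norm_num)] at h3
    simpa using ENNReal.tendsto_ofReal h3
  obtain ⟨ms, hms, hae⟩ := hmeas.exists_seq_tendsto_ae
  exact ⟨ms, hms, hae⟩

end WeakLaw

/-- The Riesz product is not absolutely continuous. -/
theorem not_absolutelyContinuous_riesz {ρ : Measure UnitAddCircle} [IsProbabilityMeasure ρ]
    (hρ : ∀ k : ℤ, ∫ x, fourier k x ∂ρ = rieszLim k) : ¬ ρ ≪ haarAddCircle (T := 1) := by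
  intro hac
  have hprod : ∀ i j : ℕ, ∀ x : UnitAddCircle,
      fourier (3 ^ i) x * starRingEnd ℂ (fourier (3 ^ j) x) = fourier (3 ^ i - 3 ^ j) x := by
    intro i j x
    rw [← fourier_neg, ← fourier_add, sub_eq_add_neg]
  have hhaar : ∀ k : ℤ, k ≠ 0 → ∫ x, fourier k x ∂(haarAddCircle (T := 1)) = 0 := by
    intro k hk
    have h := coeff_char k 0
    rw [coeff_toMT, fourierCoeff_congr_ae (fn_char k), if_neg hk.symm, fourierCoeff] at h
    simpa using h
  obtain ⟨ns, hns, hae⟩ := exists_subseq_tendsto_ae (P := haarAddCircle (T := 1))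
    (f := fun j => fourier (3 ^ j)) (m := fun _ => 0) (fun j x => norm_fourier_apply _ x)
    (fun j => hhaar _ (by positivity)) (fun i j hij => by
      simp_rw [hprod]
      rw [hhaar _ (sub_ne_zero.2 fun h => hij (pow_right_injective₀ (by norm_num) (by norm_num) h))]
      simp) tendsto_sum_rieszAmp_sq (ns := id) Filter.tendsto_id
  -- The second subsequence is taken inside the first, so that both limits hold along it.
  obtain ⟨ms, hms, hae'⟩ := exists_subseq_tendsto_ae (P := ρ)
    (f := fun j => fourier (3 ^ j)) (m := fun j => ((rieszAmp j / 2 : ℝ) : ℂ))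
    (fun j x => norm_fourier_apply _ x) (fun j => by rw [hρ, rieszLim_pow]) (fun i j hij => by
      simp_rw [hprod]
      rw [hρ, rieszLim_pow_sub_pow hij, Complex.conj_ofReal, Complex.ofReal_mul])
    tendsto_sum_rieszAmp_sq hns.tendsto_atTop
  have haeρ := hac.ae_le hae
  obtain ⟨x, hx, hx'⟩ := (Filter.Eventually.and (f := ae ρ) haeρ hae').exists
  have hx := hx.comp hms.tendsto_atTop
  have hdiff := hx.sub hx'
  -- The means are `0` under Haar measure and `a_j / 2` under `ρ`. With weights `a_j` the two
  -- averages differ by `∑ a_j (a_j / 2) / ∑ a_j ^ 2 = 1/2`, although both tend to `0` at `x`.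
  have hhalf : Filter.Tendsto (fun _ : ℕ => (1 / 2 : ℂ)) Filter.atTop (nhds (0 - 0)) := by
    refine hdiff.congr' ?_
    have hev := (tendsto_sum_rieszAmp_sq.comp
      (hns.tendsto_atTop.comp hms.tendsto_atTop)).eventually_gt_atTop 0
    filter_upwards [hev] with i hi
    simp only [Function.comp_apply, id_eq] at hi ⊢
    have hne : ((∑ j ∈ Finset.range (ns (ms i)), rieszAmp j ^ 2 : ℝ) : ℂ) ≠ 0 :=
      Complex.ofReal_ne_zero.2 hi.ne'
    rw [← sub_div, ← Finset.sum_sub_distrib, div_eq_iff hne]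
    push_cast
    rw [Finset.mul_sum]
    refine Finset.sum_congr rfl fun j _ => ?_
    ring
  have := tendsto_nhds_unique hhalf tendsto_const_nhds
  norm_num at this

/-! ### The Riesz product lies in `A` but not in `L¹(𝕋)`. -/

/-- A finite positive measure as a complex measure. -/
def MT.ofMeasure (ρ : Measure UnitAddCircle) : MT := ρ.withDensityᵥ fun _ => (1 : ℂ)

theorem MT.ofMeasure_apply (ρ : Measure UnitAddCircle) [IsFiniteMeasure ρ]
    {s : Set UnitAddCircle} (hs : MeasurableSet s) :
    (MT.ofMeasure ρ).val s = ((ρ.real s : ℝ) : ℂ) := by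
  refine (withDensityᵥ_apply (integrable_const _) hs).trans ?_
  simp

/-- The variation of `ρ` as a complex measure is `ρ`, so both integrals extend the same set function
from the same `L¹` space. -/
theorem MT.coeff_ofMeasure (ρ : Measure UnitAddCircle) [IsFiniteMeasure ρ] (k : ℤ) :
    (MT.ofMeasure ρ).coeff k = ∫ x, fourier (-k) x ∂ρ := by
  have hv : (MT.ofMeasure ρ).val.variation = ρ := by
    refine (Measure.variation_withDensityᵥ (integrable_const (1 : ℂ))).trans ?_
    simp
  rw [MT.coeff, VectorMeasure.integral_eq_setToFun, MeasureTheory.integral_eq_setToFun]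
  simp only [hv]
  refine setToFun_congr_left' _ _ (fun s hs _ => ?_) _
  ext z
  change z * (MT.ofMeasure ρ).val s = weightedSMul ρ s z
  rw [MT.ofMeasure_apply ρ hs, weightedSMul_apply, Complex.real_smul, mul_comm]

/-- Riesz–Fischer, together with `L² ⊆ L¹` for a probability measure. -/
theorem exists_L1T_coeff_eq_of_summable {c : ℤ → ℂ} (hc : Summable fun k => ‖c k‖ ^ 2) :
    ∃ f : L1T, ∀ k, f.toMT.coeff k = c k := by
  have hmem : Memℓp c 2 := memℓp_gen (by simpa using hc)
  let g : Lp ℂ 2 (haarAddCircle (T := 1)) := fourierBasis.repr.symm ⟨c, hmem⟩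
  have hg : ∀ k, fourierCoeff g k = c k := fun k => by
    rw [← fourierBasis_repr, LinearIsometryEquiv.apply_symm_apply]
  have hint : Integrable g (haarAddCircle (T := 1)) := (Lp.memLp g).integrable (by norm_num)
  exact ⟨mk g hint, fun k => by rw [coeff_toMT, fourierCoeff_congr_ae (fn_mk _ hint), hg]⟩

theorem idealL1_ne_top : idealL1.toSubmodule ≠ ⊤ := by
  obtain ⟨ρ, hprob, hρ⟩ := exists_riesz_measure
  have hcoeff : ∀ k, (MT.ofMeasure ρ).coeff k = rieszLim k := fun k => by
    rw [MT.coeff_ofMeasure, hρ, rieszLim_neg]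
  obtain ⟨f, hf⟩ := exists_L1T_coeff_eq_of_summable (c := fun k => (rieszLim k : ℂ) ^ 2) (by
    refine summable_rieszLim_pow_four.congr fun k => ?_
    rw [norm_pow, Complex.norm_real, ← pow_mul, Real.norm_eq_abs]
    exact (Even.pow_abs (by decide) _).symm)
  -- The exponent `2` suffices: `ρ * ρ` has coefficients `rieszLim k ^ 2`, which are
  -- square-summable.
  have hroot : MT.ofMeasure ρ ∈ rootsL1 := ⟨2, by norm_num, f, MT.ext_coeff fun k => by
    rw [hf, sq (MT.ofMeasure ρ), MT.coeff_mul, hcoeff, sq]⟩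
  intro htop
  have hmem : (⟨MT.ofMeasure ρ, rootsL1_subset_algA hroot⟩ : algA) ∈ idealL1.toSubmodule :=
    htop ▸ Submodule.mem_top
  have hac := (exists_toMT_eq_iff (MT.ofMeasure ρ)).1 hmem
  refine not_absolutelyContinuous_riesz hρ (Measure.AbsolutelyContinuous.mk fun s hs h0 => ?_)
  have := hac s hs h0
  rw [MT.ofMeasure_apply ρ hs, Complex.ofReal_eq_zero] at this
  exact (measureReal_eq_zero_iff).1 this

end CircleAlg

end

theorem mainTheorem5 :
    CompleteSpace CircleAlg.algA ∧
    CircleAlg.IsGelfandSemisimple CircleAlg.algA ∧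
    CircleAlg.IsGelfandSemisimple CircleAlg.L1T ∧
    (∃ (eA : ℤ ≃ₜ WeakDual.characterSpace ℂ CircleAlg.algA)
        (eB : ℤ ≃ₜ WeakDual.characterSpace ℂ CircleAlg.L1T),
      (∀ (k : ℤ) (μ : CircleAlg.algA), eA k μ = CircleAlg.MT.coeff μ k) ∧
      (∀ (k : ℤ) (f : CircleAlg.L1T), eB k f = fourierCoeff f.fn k) ∧
      ∀ (n : ℕ) (k : Fin n → ℤ), Function.Injective k → ∀ a : Fin n → ℂ,
        CircleAlg.npNorm (fun i => eA (k i)) a = CircleAlg.npNorm (fun i => eB (k i)) a) ∧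
    (¬ ∃ T : CircleAlg.algA →ₙₐ[ℂ] CircleAlg.L1T, Function.Bijective T) ∧
    (IsClosed (CircleAlg.idealL1.carrier) ∧ CircleAlg.idealL1.toSubmodule ≠ ⊤ ∧
      CircleAlg.IsRadicalAlgebra CircleAlg.idealL1.Quotient) ∧
    (∀ I : CircleAlg.AlgIdeal CircleAlg.L1T, IsClosed I.carrier → I.toSubmodule ≠ ⊤ →
      ¬ CircleAlg.IsRadicalAlgebra I.Quotient) := by
  open CircleAlg in
  obtain ⟨eA, hA⟩ := exists_homeomorph_characterSpace algA.incl_char algA.norm_incl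
    algA.exists_characterSpace_char_ne_zero
  obtain ⟨eB, hB⟩ := exists_homeomorph_characterSpace (ι := L1T.toMTₐ) (fun _ => rfl)
    L1T.norm_toMT L1T.exists_characterSpace_char_ne_zero
  exact ⟨inferInstance, isGelfandSemisimple_of_coeff algA.incl_char algA.norm_incl,
    isGelfandSemisimple_of_coeff (ι := L1T.toMTₐ) (e := L1T.char) (fun _ => rfl) L1T.norm_toMT,
    ⟨eA, eB, hA, fun k f => (hB k f).trans (L1T.coeff_toMT f k),
      fun _ _ hk a => npNorm_algA_eq_npNorm_L1T hA hB hk a⟩,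
    not_exists_bijective idealL1_ne_top,
    ⟨isClosed_idealL1, idealL1_ne_top, isRadicalAlgebra_quotient_idealL1⟩,
    not_isRadicalAlgebra_quotient_L1T⟩
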